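/- Let $G$ be a discrete group, $\beta$ a (global) action of $G$ on a C*-algebra $B$ by *-automorphisms, and $A$ a closed two-sided ideal of $B$ such that the norm closure of $\sum_{t\in G}\beta_t(A)$ is $B$; that is, $\beta$ is the C*-enveloping action of the restricted C*-partial action $\alpha:=\beta|_A=\{\alpha_t\colon A_{t^{-1}}\to A_t\}_{t\in G}$, where $A_t=A\cap\beta_t(A)$ and $\alpha_t(a)=\beta_t(a)$ for $a\in A_{t^{-1}}$. Let $A''$ and $B''$ be the bidual (enveloping) W*-algebras, let $\beta''$ be the action of $G$ on $B''$ given by the double transposes $\beta_t''$, and let $\alpha''=\{\alpha_t''\colon A_{t^{-1}}''\to A_t''\}_{t\in G}$ be the bidual W*-partial action on $A''$, where $A_t''$ is viewed as a W*-ideal of $A''$. (1) $(B'',\beta'')$, together with the canonical inclusion $\iota\colon A''\to B''$ (the double transpose of $A\hookrightarrow B$), is the W*-enveloping action of $(A'',\alpha'')$: the map $\iota$ is an isomorphism of W*-partial actions from $\alpha''$ onto the restriction of $\beta''$ to the W*-ideal $\iota(A'')$ of $B''$, and the linear span of $\bigcup_{t\in G}\beta''_t(\iota(A''))$ is weak-*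 dense in $B''$. (2) $\alpha$ is AD-amenable if and only if $\beta$ is AD-amenable. Here a global action $\sigma$ of $G$ on a W*-algebra $N$ by weak-* continuous *-automorphisms is W*AD-amenable if there is a linear, positive, contractive map $P\colon\ell^\infty(G,N)\to N$ which is $G$-equivariant for the diagonal action $(\tilde\sigma_tf)(r)=\sigma_t(f(t^{-1}r))$ on $\ell^\infty(G,N)$ and sends each constant function to its value; a W*-partial action is W*AD-amenable if its W*-enveloping action (which exists and is unique up to isomorphism) is; and a C*-action or C*-partial action is AD-amenable if its bidual W*-action, respectively W*-partial action, is W*AD-amenable. -/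

import Mathlib

open scoped ENNReal Topology

universe u v w

noncomputable section

/-! ### Closed ideals of C*-algebras and partial actions on C*-algebras -/

/-- A C*-ideal (closed two-sided *-ideal) of a C*-algebra. -/
structure CStarIdeal (A : Type u) [NonUnitalCStarAlgebra A] where
  /-- the underlying C*-subalgebra -/
  alg : NonUnitalStarSubalgebra ℂ A
  isClosed : IsClosed (alg : Set A)
  mul_mem_left : ∀ a x : A, x ∈ alg → a * x ∈ alg
  mul_mem_right : ∀ a x : A, x ∈ alg → x * a ∈ alg

instance CStarIdeal.instIsClosed {A : Type u} [NonUnitalCStarAlgebra A] (J : CStarIdeal A) :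
    IsClosed (J.alg : Set A) := J.isClosed

/-- A C*-partial action `α = {α_t : A_{t⁻¹} → A_t}` of a discrete group `G` on `A`. -/
structure CStarPartialAction (G : Type v) [Group G] (A : Type u) [NonUnitalCStarAlgebra A] where
  /-- the ideal `A_t` -/
  dom : G → CStarIdeal A
  /-- the isomorphism `α_t : A_{t⁻¹} → A_t` -/
  act : ∀ t : G, (dom t⁻¹).alg ≃⋆ₐ[ℂ] (dom t).alg
  dom_one : ∀ a : A, a ∈ (dom 1).alg
  act_one : ∀ a : (dom 1⁻¹).alg, (act 1 a : A) = a
  act_mul : ∀ (s t : G) (x : (dom t⁻¹).alg) (h : (act t x : A) ∈ (dom s⁻¹).alg),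
    ∃ h' : (x : A) ∈ (dom (s * t)⁻¹).alg, (act (s * t) ⟨x, h'⟩ : A) = act s ⟨act t x, h⟩

section Restriction

variable {G : Type v} [Group G] {B : Type u} [NonUnitalCStarAlgebra B]
  (β : G →* (B ≃⋆ₐ[ℂ] B)) (A : CStarIdeal B)

theorem act_apply_inv (t : G) (b : B) : β t (β t⁻¹ b) = b := by
  rw [← StarAlgEquiv.mul_apply, ← map_mul]; simp

theorem act_inv_apply (t : G) (b : B) : β t⁻¹ (β t b) = b := by
  rw [← StarAlgEquiv.mul_apply, ← map_mul]; simp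

/-- The ideal `A_t = A ∩ β_t(A)` of `A`, written as `{a ∈ A | β_{t⁻¹}(a) ∈ A}`. -/
def restrictDom (t : G) : CStarIdeal A.alg where
  alg := (A.alg.comap (β t⁻¹ : B →⋆ₙₐ[ℂ] B)).comap (NonUnitalStarSubalgebraClass.subtype A.alg)
  isClosed := by
    have hc : Continuous fun a : A.alg => β t⁻¹ (a : B) :=
      (StarAlgEquiv.isometry (β t⁻¹)).continuous.comp continuous_subtype_val
    exact A.isClosed.preimage hc
  mul_mem_left a x hx := by
    change β t⁻¹ ((a : B) * (x : B)) ∈ A.alg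
    rw [map_mul]
    exact A.mul_mem_left _ _ hx
  mul_mem_right a x hx := by
    change β t⁻¹ ((x : B) * (a : B)) ∈ A.alg
    rw [map_mul]
    exact A.mul_mem_right _ _ hx

theorem mem_restrictDom {t : G} {a : A.alg} :
    a ∈ (restrictDom β A t).alg ↔ β t⁻¹ (a : B) ∈ A.alg := Iff.rfl

theorem mem_restrictDom_iff_image {t : G} {a : A.alg} :
    a ∈ (restrictDom β A t).alg ↔ (a : B) ∈ β t '' (A.alg : Set B) := by
  rw [mem_restrictDom]
  constructor
  · intro h
    exact ⟨_, h, act_apply_inv β t _⟩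
  · rintro ⟨c, hc, h⟩
    rw [← h, act_inv_apply]
    exact hc

theorem mem_restrictDom_inv {t : G} {a : A.alg} :
    a ∈ (restrictDom β A t⁻¹).alg ↔ β t (a : B) ∈ A.alg := by
  rw [mem_restrictDom, inv_inv]

/-- The restriction `β_t : A_{t⁻¹} → A_t`. -/
def restrictAct (t : G) : (restrictDom β A t⁻¹).alg ≃⋆ₐ[ℂ] (restrictDom β A t).alg where
  toFun x := ⟨⟨β t ((x : A.alg) : B), (mem_restrictDom_inv β A).1 x.2⟩, by
    rw [mem_restrictDom]
    simp only [act_inv_apply]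
    exact x.1.2⟩
  invFun x := ⟨⟨β t⁻¹ ((x : A.alg) : B), x.2⟩, by
    rw [mem_restrictDom_inv]
    simp only [act_apply_inv]
    exact x.1.2⟩
  left_inv x := Subtype.ext (Subtype.ext (act_inv_apply β t _))
  right_inv x := Subtype.ext (Subtype.ext (act_apply_inv β t _))
  map_add' x y := Subtype.ext (Subtype.ext (map_add (β t) _ _))
  map_mul' x y := Subtype.ext (Subtype.ext (map_mul (β t) _ _))
  map_star' x := Subtype.ext (Subtype.ext (map_star (β t) _))
  map_smul' c x := Subtype.ext (Subtype.ext (map_smul (β t) _ _))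

/-- The restriction `α = β|_A` of a global C*-action `β` on `B` to a C*-ideal `A` of `B`:
`A_t = A ∩ β_t(A)` and `α_t(a) = β_t(a)`. -/
def restrictAction : CStarPartialAction G A.alg where
  dom := restrictDom β A
  act := restrictAct β A
  dom_one a := by
    rw [mem_restrictDom]; simp
  act_one a := Subtype.ext (by change β 1 _ = _; simp)
  act_mul s t x h := by
    have key : β (s * t) ((x : A.alg) : B) = β s (β t ((x : A.alg) : B)) := by
      rw [map_mul, StarAlgEquiv.mul_apply]
    refine ⟨?_, Subtype.ext key⟩
    rw [mem_restrictDom_inv] at h ⊢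
    rw [key]
    exact h

/-- `β` is the C*-enveloping action of `β|_A`: the closed linear span of `⋃ t, β_t(A)` is `B`. -/
def IsCStarEnveloping : Prop :=
  closure (Submodule.span ℂ (⋃ t : G, β t '' (A.alg : Set B)) : Set B) = Set.univ

end Restriction

/-! ### W*-algebras, viewed as Banach space duals `M = (M_*)'` -/

/-- The weak-* topology of the dual of `E`. -/
abbrev wstar (E : Type u) [NormedAddCommGroup E] [NormedSpace ℂ E] :
    TopologicalSpace (StrongDual ℂ E) :=
  TopologicalSpace.induced StrongDual.toWeakDual (inferInstance : TopologicalSpace (WeakDual ℂ E))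

/-- A multiplication and an involution on the dual of `E`; no law is part of the data. -/
structure DualStarAlgebra (E : Type u) [NormedAddCommGroup E] [NormedSpace ℂ E] where
  mul : StrongDual ℂ E → StrongDual ℂ E → StrongDual ℂ E
  star : StrongDual ℂ E → StrongDual ℂ E

namespace DualStarAlgebra

variable {E : Type u} [NormedAddCommGroup E] [NormedSpace ℂ E] (M : DualStarAlgebra E)

/-- `M` is a W*-algebra with predual `E`: `E` is a Banach space, and `M = E'` with its dual norm
is a unital C*-algebra (Sakai's definition). -/
structure IsWStarAlgebra : Prop where
  complete : CompleteSpace E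
  mul_assoc : ∀ x y z, M.mul (M.mul x y) z = M.mul x (M.mul y z)
  add_mul : ∀ x y z, M.mul (x + y) z = M.mul x z + M.mul y z
  mul_add : ∀ x y z, M.mul x (y + z) = M.mul x y + M.mul x z
  smul_mul : ∀ (c : ℂ) (x y), M.mul (c • x) y = c • M.mul x y
  mul_smul : ∀ (c : ℂ) (x y), M.mul x (c • y) = c • M.mul x y
  exists_one : ∃ e, ∀ x, M.mul e x = x ∧ M.mul x e = x
  star_star : ∀ x, M.star (M.star x) = x
  star_add : ∀ x y, M.star (x + y) = M.star x + M.star y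
  star_smul : ∀ (c : ℂ) (x), M.star (c • x) = (starRingEnd ℂ c) • M.star x
  star_mul : ∀ x y, M.star (M.mul x y) = M.mul (M.star y) (M.star x)
  norm_mul_le : ∀ x y, ‖M.mul x y‖ ≤ ‖x‖ * ‖y‖
  norm_star_mul_self : ∀ x, ‖M.mul (M.star x) x‖ = ‖x‖ * ‖x‖

/-- A W*-ideal: a two-sided *-ideal that is closed in the weak-* topology. -/
structure IsWStarIdeal (I : Submodule ℂ (StrongDual ℂ E)) : Prop where
  mul_mem_left : ∀ a, ∀ x ∈ I, M.mul a x ∈ I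
  mul_mem_right : ∀ a, ∀ x ∈ I, M.mul x a ∈ I
  star_mem : ∀ x ∈ I, M.star x ∈ I
  isClosed : IsClosed[wstar E] (I : Set (StrongDual ℂ E))

/-- Positive elements: those of the form `y* y`. -/
def IsPos (x : StrongDual ℂ E) : Prop := ∃ y, x = M.mul (M.star y) y

end DualStarAlgebra

/-! ### W*-partial actions and W*-actions -/

/-- A family of linear maps `γ_t : M_{t⁻¹} → M_t` between subspaces of a vector space `X`. -/
structure PartialFamily (G : Type v) [Group G] (X : Type u) [AddCommGroup X] [Module ℂ X] where
  dom : G → Submodule ℂ X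
  act : ∀ t : G, dom t⁻¹ →ₗ[ℂ] dom t

section WStarActions

variable {G : Type v} [Group G] {E : Type u} [NormedAddCommGroup E] [NormedSpace ℂ E]
  {F : Type w} [NormedAddCommGroup F] [NormedSpace ℂ F]

/-- `γ` is a W*-partial action of the discrete group `G` on the W*-algebra `M`: it is a
set-theoretic partial action, each `M_t` is a W*-ideal and each `γ_t` is a W*-isomorphism. -/
structure IsWStarPartialAction (M : DualStarAlgebra E) (γ : PartialFamily G (StrongDual ℂ E)) :
    Prop where
  isWStarAlgebra : M.IsWStarAlgebra
  ideal : ∀ t, M.IsWStarIdeal (γ.dom t)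
  bijective : ∀ t, Function.Bijective (γ.act t)
  map_mul : ∀ (t : G) (x y z : γ.dom t⁻¹), (z : StrongDual ℂ E) = M.mul x y →
    (γ.act t z : StrongDual ℂ E) = M.mul (γ.act t x) (γ.act t y)
  map_star : ∀ (t : G) (x z : γ.dom t⁻¹), (z : StrongDual ℂ E) = M.star x →
    (γ.act t z : StrongDual ℂ E) = M.star (γ.act t x)
  wstar_continuous : ∀ t : G, Continuous[(wstar E).induced Subtype.val, wstar E]
    (fun x : γ.dom t⁻¹ => (γ.act t x : StrongDual ℂ E))
  dom_one : γ.dom 1 = ⊤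
  act_one : ∀ x : γ.dom 1⁻¹, (γ.act 1 x : StrongDual ℂ E) = x
  act_mul : ∀ (s t : G) (x : γ.dom t⁻¹) (h : (γ.act t x : StrongDual ℂ E) ∈ γ.dom s⁻¹),
    ∃ h' : (x : StrongDual ℂ E) ∈ γ.dom (s * t)⁻¹,
      (γ.act (s * t) ⟨x, h'⟩ : StrongDual ℂ E) = γ.act s ⟨γ.act t x, h⟩

/-- `σ` is a (global) W*-action of `G` on the W*-algebra `N`. -/
structure IsWStarAction (N : DualStarAlgebra F)
    (σ : G → StrongDual ℂ F →ₗ[ℂ] StrongDual ℂ F) : Prop where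
  isWStarAlgebra : N.IsWStarAlgebra
  map_mul : ∀ t x y, σ t (N.mul x y) = N.mul (σ t x) (σ t y)
  map_star : ∀ t x, σ t (N.star x) = N.star (σ t x)
  wstar_continuous : ∀ t, Continuous[wstar F, wstar F] (σ t)
  act_one : ∀ x, σ 1 x = x
  act_mul : ∀ s t x, σ (s * t) x = σ s (σ t x)

/-- `(N, σ)` is a W*-enveloping action of the W*-partial action `(M, γ)` through `ι : M → N`:
`ι` is an isomorphism of W*-partial actions from `γ` onto the restriction of `σ` to the W*-ideal
`ι(M)` of `N` (so `ι(M_t) = ι(M) ∩ σ_t(ι(M))`), and the linear `σ`-orbit of `ι(M)` is weak-*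
dense in `N`. -/
structure IsWStarEnveloping (M : DualStarAlgebra E) (γ : PartialFamily G (StrongDual ℂ E))
    (N : DualStarAlgebra F) (σ : G → StrongDual ℂ F →ₗ[ℂ] StrongDual ℂ F)
    (ι : StrongDual ℂ E →ₗ[ℂ] StrongDual ℂ F) : Prop where
  isWStarPartialAction : IsWStarPartialAction M γ
  isWStarAction : IsWStarAction N σ
  ideal : N.IsWStarIdeal (LinearMap.range ι)
  map_mul : ∀ x y, ι (M.mul x y) = N.mul (ι x) (ι y)
  map_star : ∀ x, ι (M.star x) = N.star (ι x)
  wstar_embedding : @Topology.IsEmbedding _ _ (wstar E) (wstar F) ι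
  map_dom : ∀ t, ι '' (γ.dom t) = Set.range ι ∩ σ t '' Set.range ι
  map_act : ∀ (t : G) (x : γ.dom t⁻¹), ι (γ.act t x) = σ t (ι x)
  dense : @closure _ (wstar F)
    (Submodule.span ℂ (⋃ t : G, σ t '' Set.range ι) : Set (StrongDual ℂ F)) = Set.univ

/-- W*AD-amenability of a global W*-action: there is a linear, positive, contractive, equivariant
map `P : ℓ^∞(G, N) → N` that restricts to the identity on constant functions, where `ℓ^∞(G, N)`
carries the diagonal action `(σ̃_t f)(r) = σ_t(f(t⁻¹ r))`. -/
def WStarADAmenable (N : DualStarAlgebra F)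
    (σ : G → StrongDual ℂ F →ₗ[ℂ] StrongDual ℂ F) : Prop :=
  ∃ P : lp (fun _ : G => StrongDual ℂ F) ∞ →ₗ[ℂ] StrongDual ℂ F,
    (∀ f h : lp (fun _ : G => StrongDual ℂ F) ∞,
      (∀ r, f r = N.mul (N.star (h r)) (h r)) → N.IsPos (P f)) ∧
    (∀ f, ‖P f‖ ≤ ‖f‖) ∧
    (∀ (t : G) (f g : lp (fun _ : G => StrongDual ℂ F) ∞),
      (∀ r, g r = σ t (f (t⁻¹ * r))) → P g = σ t (P f)) ∧
    (∀ (x : StrongDual ℂ F) (f : lp (fun _ : G => StrongDual ℂ F) ∞), (∀ r, f r = x) → P f = x)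

end WStarActions

/-- A W*-partial action is W*AD-amenable if its W*-enveloping action is W*AD-amenable. -/
def PartialWStarADAmenable {G : Type v} [Group G] {E : Type u} [NormedAddCommGroup E]
    [NormedSpace ℂ E] (M : DualStarAlgebra E) (γ : PartialFamily G (StrongDual ℂ E)) : Prop :=
  ∃ (F : Type (max u v)) (_ : NormedAddCommGroup F) (_ : NormedSpace ℂ F)
    (N : DualStarAlgebra F) (σ : G → StrongDual ℂ F →ₗ[ℂ] StrongDual ℂ F)
    (ι : StrongDual ℂ E →ₗ[ℂ] StrongDual ℂ F),
    IsWStarEnveloping M γ N σ ι ∧ WStarADAmenable N σ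

/-! ### The bidual W*-algebra and bidual partial actions -/

section Bidual

/-- The double transpose `f'' : E'' → F''`, given by `f''(Φ)(φ) = Φ(φ ∘ f)`. -/
def bidualMap {E : Type u} [NormedAddCommGroup E] [NormedSpace ℂ E]
    {F : Type w} [NormedAddCommGroup F] [NormedSpace ℂ F] (f : E →L[ℂ] F) :
    StrongDual ℂ (StrongDual ℂ E) →L[ℂ] StrongDual ℂ (StrongDual ℂ F) :=
  ContinuousLinearMap.precomp ℂ (ContinuousLinearMap.precomp ℂ f)

theorem bidualMap_apply {E : Type u} [NormedAddCommGroup E] [NormedSpace ℂ E]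
    {F : Type w} [NormedAddCommGroup F] [NormedSpace ℂ F] (f : E →L[ℂ] F)
    (Φ : StrongDual ℂ (StrongDual ℂ E)) (φ : StrongDual ℂ F) :
    bidualMap f Φ φ = Φ (φ.comp f) := rfl

/-- The double transpose of an inclusion is injective, by the Hahn-Banach theorem. -/
theorem bidualMap_subtypeL_injective {E : Type u} [NormedAddCommGroup E] [NormedSpace ℂ E]
    (p : Submodule ℂ E) : Function.Injective (bidualMap p.subtypeL) := by
  intro Φ Ψ h
  ext φ
  obtain ⟨g, hg, -⟩ := exists_extension_norm_eq p φ
  have hcomp : g.comp p.subtypeL = φ := by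
    ext x
    exact hg x
  have := DFunLike.congr_fun h g
  rwa [bidualMap_apply, bidualMap_apply, hcomp] at this

variable (A : Type u) [NonUnitalCStarAlgebra A]

variable {A} in
/-- `(Φ · φ)(a) = Φ(b ↦ φ(a b))` for `Φ ∈ A''` and `φ ∈ A'`, as a map `A' → A'`. -/
def arensAct (Φ : StrongDual ℂ (StrongDual ℂ A)) : StrongDual ℂ A →L[ℂ] StrongDual ℂ A :=
  (ContinuousLinearMap.compL ℂ A (StrongDual ℂ A) ℂ Φ).comp
    (((ContinuousLinearMap.compL ℂ A (A →L[ℂ] A) (StrongDual ℂ A)).flip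
      (ContinuousLinearMap.mul ℂ A)).comp (ContinuousLinearMap.compL ℂ A A ℂ))

theorem arensAct_apply (Φ : StrongDual ℂ (StrongDual ℂ A)) (φ : StrongDual ℂ A) (a : A) :
    arensAct Φ φ a = Φ (φ.comp (ContinuousLinearMap.mul ℂ A a)) := rfl

variable {A} in
/-- `φ*(a) = conj (φ(a*))` for `φ ∈ A'`. -/
def dualStar (φ : StrongDual ℂ A) : StrongDual ℂ A :=
  ((starL ℂ : ℂ ≃L⋆[ℂ] ℂ) : ℂ →L⋆[ℂ] ℂ).comp (φ.comp ((starL ℂ : A ≃L⋆[ℂ] A) : A →L⋆[ℂ] A))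

theorem dualStar_apply (φ : StrongDual ℂ A) (a : A) :
    dualStar φ a = star (φ (star a)) := rfl

/-- The map `φ ↦ φ*` as a continuous conjugate-linear map. -/
def dualStarL : StrongDual ℂ A →L⋆[ℂ] StrongDual ℂ A :=
  LinearMap.mkContinuous
    { toFun := dualStar
      map_add' := fun φ ψ => by ext a; simp [dualStar_apply]
      map_smul' := fun c φ => by ext a; simp [dualStar_apply] } 1 (fun φ => by
      rw [one_mul]
      refine ContinuousLinearMap.opNorm_le_bound _ (norm_nonneg _) fun a => ?_
      change ‖star (φ (star a))‖ ≤ _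
      rw [norm_star]
      exact (φ.le_opNorm _).trans_eq (by rw [norm_star]))

/-- The enveloping algebra `A''` of a C*-algebra `A`: the Banach space bidual with the (first)
Arens product `(Φ Ψ)(φ) = Φ(Ψ · φ)` and the involution `Φ*(φ) = conj (Φ(φ*))`. -/
def bidual : DualStarAlgebra (StrongDual ℂ A) where
  mul Φ Ψ := Φ.comp (arensAct Ψ)
  star Φ := ((starL ℂ : ℂ ≃L⋆[ℂ] ℂ) : ℂ →L⋆[ℂ] ℂ).comp (Φ.comp (dualStarL A))

theorem bidual_mul_apply (Φ Ψ : StrongDual ℂ (StrongDual ℂ A)) (φ : StrongDual ℂ A) :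
    (bidual A).mul Φ Ψ φ = Φ (arensAct Ψ φ) := rfl

theorem bidual_star_apply (Φ : StrongDual ℂ (StrongDual ℂ A)) (φ : StrongDual ℂ A) :
    (bidual A).star Φ φ = star (Φ (dualStar φ)) := rfl

variable {A}

/-- The inclusion of a C*-ideal as a continuous linear map. -/
def CStarIdeal.incl (J : CStarIdeal A) : J.alg →L[ℂ] A := J.alg.toSubmodule.subtypeL

theorem CStarIdeal.incl_apply (J : CStarIdeal A) (x : J.alg) : J.incl x = x := rfl

/-- The canonical embedding `J'' → A''` for a C*-ideal `J` of `A`. -/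
def CStarIdeal.bidualIncl (J : CStarIdeal A) :
    StrongDual ℂ (StrongDual ℂ J.alg) →ₗ[ℂ] StrongDual ℂ (StrongDual ℂ A) :=
  (bidualMap J.incl).toLinearMap

theorem CStarIdeal.bidualIncl_injective (J : CStarIdeal A) :
    Function.Injective J.bidualIncl :=
  bidualMap_subtypeL_injective J.alg.toSubmodule

/-- `J''`, viewed as a subspace of `A''`. -/
def CStarIdeal.bidualRange (J : CStarIdeal A) : Submodule ℂ (StrongDual ℂ (StrongDual ℂ A)) :=
  LinearMap.range J.bidualIncl

/-- `J''` is identified with its image in `A''`. -/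
def CStarIdeal.bidualEquiv (J : CStarIdeal A) :
    StrongDual ℂ (StrongDual ℂ J.alg) ≃ₗ[ℂ] J.bidualRange :=
  LinearEquiv.ofInjective J.bidualIncl J.bidualIncl_injective

/-- A *-isomorphism of C*-algebras as a (necessarily) continuous linear map. -/
def starIsoL {B : Type u} [NonUnitalCStarAlgebra B] (φ : A ≃⋆ₐ[ℂ] B) : A →L[ℂ] B where
  toFun := φ
  map_add' := map_add φ
  map_smul' := map_smul φ
  cont := (StarAlgEquiv.isometry φ).continuous

variable {G : Type v} [Group G]

/-- The bidual partial action `α''`: `A_t''` is viewed as a subspace of `A''`, and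
`α_t'' : A_{t⁻¹}'' → A_t''` is the double transpose of `α_t`. -/
def CStarPartialAction.bidual (α : CStarPartialAction G A) :
    PartialFamily G (StrongDual ℂ (StrongDual ℂ A)) where
  dom t := (α.dom t).bidualRange
  act t := (α.dom t).bidualEquiv.toLinearMap ∘ₗ
    (bidualMap (starIsoL (α.act t))).toLinearMap ∘ₗ (α.dom t⁻¹).bidualEquiv.symm.toLinearMap

/-- The bidual `β''` of a global C*-action `β`: `β_t''` is the double transpose of `β_t`. -/
def bidualAction (β : G →* (A ≃⋆ₐ[ℂ] A)) (t : G) :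
    StrongDual ℂ (StrongDual ℂ A) →ₗ[ℂ] StrongDual ℂ (StrongDual ℂ A) :=
  (bidualMap (starIsoL (β t))).toLinearMap

/-- AD-amenability of a global C*-action: `β''` is W*AD-amenable. -/
def ADAmenable (β : G →* (A ≃⋆ₐ[ℂ] A)) : Prop :=
  WStarADAmenable (bidual A) (bidualAction β)

/-- AD-amenability of a C*-partial action: `α''` is W*AD-amenable. -/
def CStarPartialAction.ADAmenable (α : CStarPartialAction G A) : Prop :=
  PartialWStarADAmenable (_root_.bidual A) α.bidual

end Bidual

end

/-! Part (1) is duality. By Hahn-Banach, `J''` sits in `A''` as the annihilator of the functionals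
vanishing on `J` (`CStarIdeal.mem_bidualRange_iff`), so ideals pass to weak-* closed ideals. The
identity `A'' ∩ β_t''(A'') = (A ∩ β_t(A))''` holds because `J''` has a unit `e`: if `x` lies in
`I''` and `J''`, then `x = x e`, and a functional vanishing on `I ∩ J` vanishes on all products `a
b` with `a ∈ I`, `b ∈ J`. Density holds because a functional in `B'` that is killed by every
`β_t''(A'')` vanishes on every `β_t(A)`, hence on `B`. That the Arens bidual is a W*-algebra has two
non-formal ingredients: the involution reverses products, and the C*-identity. Both follow once
every functional is written as a coefficient of a GNS representation
(`exists_hilbert_factorization`), where Arens products become inner products.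

Amenability of a partial action only asks that some W*-enveloping action be amenable, so Part (2)
reduces to the uniqueness of that action (`IsWStarEnveloping.exists_equiv`). Let `p_t` be the unit
of the ideal `σ_t(ι(M))`, a central projection. An element `x` is determined by its pieces `p_t x`,
and bounded compatible families of pieces glue to an element. The pieces can be moved into `M`,
where compatibility only involves the partial action; reassembling them in the second enveloping
algebra gives the isomorphism. Gluing needs multiplication by `p_t` to be weak-* continuous, which
Sakai's definition does not include. It is obtained from norms alone: multiplication by a central
projection satisfies `‖p x + (1 - p) y‖ ≤ max ‖x‖ ‖y‖`, and such projections on a dual Banach space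
are automatically weak-* continuous (`IsMaxProjection.exists_predual`). -/

noncomputable section

open scoped ComplexOrder InnerProductSpace
open Filter

/-! ### Positive functionals on C*-algebras and domination by quasi-states. -/

section States

/-- A contractive functional on a unital C*-algebra with value one at the unit is positive. -/
theorem nonneg_of_norm_le_one_of_map_one {U : Type*} [CStarAlgebra U] (g : StrongDual ℂ U)
    (hg : ‖g‖ ≤ 1) (h1 : g 1 = 1) (y : U) : 0 ≤ g (star y * y) := by
  let := CStarAlgebra.spectralOrder U
  let := CStarAlgebra.spectralOrderedRing U
  set h := star y * y with hh
  have hle (x : U) : ‖g x‖ ≤ ‖x‖ := by simpa using g.le_of_opNorm_le hg x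
  have hsa : star h = h := by simp [hh]
  have hpos : 0 ≤ h := star_mul_self_nonneg y
  have him : (g h).im = 0 := by
    -- Evaluating `g` at `h + iT·1`, whose squared norm is at most `‖h‖² + T²`: the `T²` terms
    -- cancel and leave a bound on an expression affine in `T`, which forces the imaginary part to
    -- vanish.
    have key (T : ℝ) : (g h).im ^ 2 + 2 * T * (g h).im ≤ ‖h‖ ^ 2 := by
      have h2 : ‖g (h + (T * Complex.I) • 1)‖ ^ 2 ≤ ‖h‖ ^ 2 + T ^ 2 * ‖(1 : U)‖ := by
        calc _ ≤ ‖h + (T * Complex.I) • (1 : U)‖ ^ 2 := by gcongr; exact hle _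
          _ = ‖star (h + (T * Complex.I) • (1 : U)) * (h + (T * Complex.I) • 1)‖ := by
            rw [CStarRing.norm_star_mul_self, sq]
          _ = ‖h * h + ((T ^ 2 : ℝ) : ℂ) • (1 : U)‖ := by
            congr 1
            simp only [star_add, hsa, star_smul, star_one, add_mul, mul_add, smul_mul_assoc,
              mul_smul_comm, one_mul, mul_one, smul_add, smul_smul]
            have : star (T * Complex.I) = -(T * Complex.I) := by simp
            rw [this]
            have e : (T * Complex.I) * -(T * Complex.I) = ((T ^ 2 : ℝ) : ℂ) := by
              linear_combination (norm := (push_cast; ring)) (-(T : ℂ) ^ 2) * Complex.I_sq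
            rw [e]
            module
          _ ≤ ‖h * h‖ + ‖((T ^ 2 : ℝ) : ℂ) • (1 : U)‖ := norm_add_le _ _
          _ ≤ _ := by
            rw [norm_smul, Complex.norm_real, Real.norm_of_nonneg (sq_nonneg T), sq ‖h‖]
            gcongr
            exact norm_mul_le _ _
      have h3 : ‖(1 : U)‖ ≤ 1 := by
        rcases subsingleton_or_nontrivial U with _ | _
        · simp [Subsingleton.elim (1 : U) 0]
        · simp
      rw [map_add, map_smul, h1, ← Complex.normSq_eq_norm_sq, Complex.normSq_apply] at h2
      simp at h2
      nlinarith [sq_nonneg T, sq_nonneg (g h).re]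
    by_contra hne
    have hpos' : 0 < (g h).im ^ 2 := by positivity
    have := key ((‖h‖ ^ 2 + 1) / (2 * (g h).im))
    have e : 2 * ((‖h‖ ^ 2 + 1) / (2 * (g h).im)) * (g h).im = ‖h‖ ^ 2 + 1 := by
      field_simp
    rw [e] at this
    linarith
  have hre : 0 ≤ (g h).re := by
    -- From `0 ≤ h ≤ ‖h‖·1`; applying the contraction `g` then gives `|‖h‖ - Re g(h)| ≤ ‖h‖`.
    have h2 : ‖(‖h‖ : ℂ) • (1 : U) - h‖ ≤ ‖h‖ := by
      have hh1 : h ≤ algebraMap ℝ U ‖h‖ := IsSelfAdjoint.le_algebraMap_norm_self (a := h) hsa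
      have hr : algebraMap ℝ U ‖h‖ = (‖h‖ : ℂ) • (1 : U) := by
        rw [Algebra.algebraMap_eq_smul_one]; simp
      rw [← hr]
      rw [CStarAlgebra.norm_le_iff_le_algebraMap _ (norm_nonneg _) (sub_nonneg.2 hh1)]
      simpa using hpos
    have h3 := (hle _).trans h2
    rw [map_sub, map_smul, h1] at h3
    have h4 := (Complex.abs_re_le_norm _).trans h3
    simp at h4
    linarith [(abs_le.1 h4).2]
  rw [Complex.nonneg_iff]
  exact ⟨hre, him.symm⟩

/-- The norm of the positive element `y* y` lies in its spectrum, hence is the value of a character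
of the C*-subalgebra it generates with the unit; a norm-preserving extension of that character
serves. -/
theorem exists_functional_of_nonneg {U : Type*} [CStarAlgebra U] [Nontrivial U] (y : U) :
    ∃ g : StrongDual ℂ U, ‖g‖ ≤ 1 ∧ g 1 = 1 ∧ g (star y * y) = (‖y‖ : ℂ) ^ 2 := by
  let := CStarAlgebra.spectralOrder U
  let := CStarAlgebra.spectralOrderedRing U
  set h := star y * y with hh
  have hsa : IsSelfAdjoint h := IsSelfAdjoint.star_mul_self y
  have : IsStarNormal h := hsa.isStarNormal
  let S := StarAlgebra.elemental ℂ h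
  let a : S := ⟨h, StarAlgebra.elemental.self_mem ℂ h⟩
  have hmem : (‖h‖ : ℂ) ∈ spectrum ℂ a := by
    have h1 : ‖h‖ ∈ spectrum ℝ h := CStarAlgebra.norm_mem_spectrum_of_nonneg (star_mul_self_nonneg y)
    have : (‖h‖ : ℂ) ∈ spectrum ℂ h := by
      simpa using spectrum.algebraMap_mem ℂ h1
    have : IsClosed (S : Set U) := StarAlgebra.elemental.isClosed ℂ h
    rwa [StarSubalgebra.mem_spectrum_iff (S := S)]
  obtain ⟨f, hf⟩ := WeakDual.CharacterSpace.mem_spectrum_iff_exists.1 hmem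
  obtain ⟨g, hg, hgn⟩ := exists_extension_norm_eq (𝕜 := ℂ) S.toSubalgebra.toSubmodule
    (WeakDual.toStrongDual (f : WeakDual ℂ S))
  refine ⟨g, ?_, ?_, ?_⟩
  · exact hgn.le.trans ((WeakDual.CharacterSpace.norm_le_norm_one f).trans (by simp))
  · have := hg (1 : S)
    exact this.trans (map_one f)
  · have := hg a
    rw [CStarRing.norm_star_mul_self] at hf
    refine this.trans (hf.trans ?_)
    push_cast; ring
/-- Separation of a point from a weak-* closed convex set by an evaluation. -/
theorem exists_eval_separating {E : Type*} [NormedAddCommGroup E] [NormedSpace ℂ E]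
    {s : Set (WeakDual ℂ E)} (hs : Convex ℝ s) (hc : IsClosed s) {φ : WeakDual ℂ E} (hφ : φ ∉ s) :
    ∃ (a : E) (c : ℝ), (∀ ψ ∈ s, (ψ a).re < c) ∧ c < (φ a).re := by
  have : IsScalarTower ℝ ℂ (WeakDual ℂ E) := inferInstanceAs (IsScalarTower ℝ ℂ (StrongDual ℂ E))
  obtain ⟨f, c, hf, hc⟩ := @RCLike.geometric_hahn_banach_closed_point ℂ (WeakDual ℂ E) _ _ _ s φ _ _ _
    _ _ (WeakDual.withSeminorms ℂ E).toLocallyConvexSpace hs hc hφ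
  obtain ⟨a, rfl⟩ := LinearMap.dualEmbedding_surjective (topDualPairing ℂ E) f
  exact ⟨a, c, hf, hc⟩

variable {A : Type u} [NonUnitalCStarAlgebra A]

/-- The positive functionals of norm at most one. -/
def quasiStates (A : Type u) [NonUnitalCStarAlgebra A] : Set (StrongDual ℂ A) :=
  {ω | ‖ω‖ ≤ 1 ∧ ∀ x : A, 0 ≤ ω (star x * x)}

/-- Such a functional exists on the unitization, where it is positive because it is contractive and
unital; its restriction to `A` remains positive and contractive. -/
theorem exists_quasiState_norm_sq (a : A) :
    ∃ ω ∈ quasiStates A, ω (star a * a) = (‖a‖ : ℂ) ^ 2 := by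
  have : Nontrivial (Unitization ℂ A) := inferInstance
  obtain ⟨g, hg, h1, h2⟩ := exists_functional_of_nonneg (a : Unitization ℂ A)
  refine ⟨g.comp (LinearMap.mkContinuous (Unitization.inrHom ℂ ℂ A) 1 fun x => ?_),
    ⟨?_, fun x => ?_⟩, ?_⟩
  · simp [Unitization.norm_inr (𝕜 := ℂ)]
  · refine ContinuousLinearMap.opNorm_le_bound _ zero_le_one fun x => ?_
    exact (g.le_of_opNorm_le hg _).trans (by simp [Unitization.norm_inr (𝕜 := ℂ)])
  · have := nonneg_of_norm_le_one_of_map_one g hg h1 (x : Unitization ℂ A)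
    simpa using this
  · simpa [Unitization.norm_inr (𝕜 := ℂ)] using h2

/-- A positive functional as a positive linear map for the spectral order. -/
def toPositiveLinearMap [PartialOrder A] [StarOrderedRing A] (ω : StrongDual ℂ A)
    (h : ∀ x : A, 0 ≤ ω (star x * x)) : A →ₚ[ℂ] ℂ :=
  PositiveLinearMap.mk₀ ω.toLinearMap fun a ha => by
    rw [CStarAlgebra.nonneg_iff_eq_star_mul_self] at ha
    obtain ⟨b, rfl⟩ := ha
    exact h b

/-- Cauchy-Schwarz for the pre-inner product `(y, x) ↦ ω(y* x)`. -/
theorem norm_apply_star_mul_sq_le (ω : StrongDual ℂ A) (h : ∀ x : A, 0 ≤ ω (star x * x))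
    (x y : A) : ‖ω (star y * x)‖ ^ 2 ≤ (ω (star y * y)).re * (ω (star x * x)).re := by
  let := CStarAlgebra.spectralOrder A
  let := CStarAlgebra.spectralOrderedRing A
  let f := toPositiveLinearMap ω h
  have := norm_inner_le_norm (𝕜 := ℂ) (f.toPreGNS y) (f.toPreGNS x)
  have h2 := pow_le_pow_left₀ (norm_nonneg _) this 2
  rw [mul_pow, f.preGNS_norm_def, f.preGNS_norm_def] at h2
  refine h2.trans_eq ?_
  rw [Real.sq_sqrt, Real.sq_sqrt]
  · rfl
  · exact (Complex.nonneg_iff.1 (h x)).1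
  · exact (Complex.nonneg_iff.1 (h y)).1

theorem isCompact_quasiStates :
    IsCompact {ω : WeakDual ℂ A | WeakDual.toStrongDual ω ∈ quasiStates A} := by
  have h1 := WeakDual.isCompact_closedBall (𝕜 := ℂ) (0 : StrongDual ℂ A) 1
  have h2 : IsClosed {ω : WeakDual ℂ A | ∀ x : A, 0 ≤ ω (star x * x)} := by
    simp only [Set.ofPred_forall]
    exact isClosed_iInter fun x => isClosed_le continuous_const (WeakDual.eval_continuous _)
  convert h1.inter_right h2 using 1
  ext ω
  simp [quasiStates, dist_zero_right]

/-- Every contractive functional is dominated by a quasi-state. -/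
theorem exists_quasiState_dominating (φ : StrongDual ℂ A) (hφ : ‖φ‖ ≤ 1) :
    ∃ ω ∈ quasiStates A, ∀ x, ‖φ x‖ ^ 2 ≤ (ω (star x * x)).re := by
  -- The pairs (functional, dominating quasi-state) form a weak-* compact convex set. Its first
  -- projection is therefore closed and convex, so a functional outside it could be separated from
  -- it by an element of `A`.
  let K : Set (WeakDual ℂ A × WeakDual ℂ A) :=
    ((WeakDual.toStrongDual ⁻¹' Metric.closedBall (0 : StrongDual ℂ A) 1) ×ˢ
      {ω | WeakDual.toStrongDual ω ∈ quasiStates A}) ∩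
    {q | ∀ x : A, ‖q.1 x‖ ^ 2 ≤ (q.2 (star x * x)).re}
  have hK : IsCompact K := by
    refine ((WeakDual.isCompact_closedBall _ _).prod isCompact_quasiStates).inter_right ?_
    simp only [Set.ofPred_forall]
    refine isClosed_iInter fun x => isClosed_le ?_ ?_
    · exact (((WeakDual.eval_continuous x).comp continuous_fst).norm).pow 2
    · exact Complex.continuous_re.comp ((WeakDual.eval_continuous _).comp continuous_snd)
  have hC : IsClosed (Prod.fst '' K) := (hK.image continuous_fst).isClosed
  have hconv : Convex ℝ (Prod.fst '' K) := by
    refine Convex.linear_image ?_ (LinearMap.fst ℝ (WeakDual ℂ A) (WeakDual ℂ A))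
    rintro ⟨φ₁, ω₁⟩ ⟨⟨h1, h1', h1''⟩, h1'''⟩ ⟨φ₂, ω₂⟩ ⟨⟨h2, h2', h2''⟩, h2'''⟩ a b ha hb hab
    have hball := convex_closedBall (0 : StrongDual ℂ A) 1
    refine ⟨⟨hball h1 h2 ha hb hab, ?_, fun x => ?_⟩, fun x => ?_⟩
    · have := @hball (WeakDual.toStrongDual ω₁) (by simpa using h1')
        (WeakDual.toStrongDual ω₂) (by simpa using h2') a b ha hb hab
      exact mem_closedBall_zero_iff.1 this
    · change 0 ≤ a • ω₁ (star x * x) + b • ω₂ (star x * x)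
      exact add_nonneg (smul_nonneg ha (h1'' x)) (smul_nonneg hb (h2'' x))
    · change ‖a • φ₁ x + b • φ₂ x‖ ^ 2 ≤ (a • ω₁ (star x * x) + b • ω₂ (star x * x)).re
      have e1 : ‖φ₁ x‖ ^ 2 ≤ (ω₁ (star x * x)).re := h1''' x
      have e2 : ‖φ₂ x‖ ^ 2 ≤ (ω₂ (star x * x)).re := h2''' x
      have hb' : b = 1 - a := by linarith
      have e3 : ‖a • φ₁ x + b • φ₂ x‖ ≤ a * ‖φ₁ x‖ + b * ‖φ₂ x‖ := by
        refine (norm_add_le _ _).trans_eq ?_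
        rw [norm_smul, norm_smul, Real.norm_of_nonneg ha, Real.norm_of_nonneg hb]
      have e4 : (a * ‖φ₁ x‖ + b * ‖φ₂ x‖) ^ 2 ≤ a * ‖φ₁ x‖ ^ 2 + b * ‖φ₂ x‖ ^ 2 := by
        subst hb'
        nlinarith [mul_nonneg (mul_nonneg ha hb) (sq_nonneg (‖φ₁ x‖ - ‖φ₂ x‖))]
      calc _ ≤ _ := pow_le_pow_left₀ (norm_nonneg _) e3 2
        _ ≤ _ := e4
        _ ≤ a * (ω₁ (star x * x)).re + b * (ω₂ (star x * x)).re := by gcongr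
        _ = _ := by simp
  suffices h : StrongDual.toWeakDual φ ∈ Prod.fst '' K by
    obtain ⟨⟨φ', ω⟩, ⟨⟨_, h2⟩, h3⟩, rfl⟩ := h
    exact ⟨_, h2, h3⟩
  by_contra hn
  obtain ⟨a, c, hf, hc⟩ := exists_eval_separating hconv hC hn
  have h1 : ‖a‖ < c := by
    obtain ⟨ω, hω, hωa⟩ := exists_quasiState_norm_sq a
    -- By Cauchy-Schwarz and `ω(a* a) = ‖a‖²`, this functional is dominated by `ω`, and it attains
    -- the value `‖a‖` at the separating element `a`. No contractive functional exceeds that, so `φ`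
    -- cannot be separated.
    let ψ : StrongDual ℂ A := (‖a‖ : ℂ)⁻¹ • ω.comp (ContinuousLinearMap.mul ℂ A (star a))
    have hψ (x : A) : ‖ψ x‖ ^ 2 ≤ (ω (star x * x)).re := by
      have h3 : 0 ≤ (ω (star x * x)).re := (Complex.nonneg_iff.1 (hω.2 x)).1
      have h4 := norm_apply_star_mul_sq_le ω hω.2 x a
      have h5 : (ω (star a * a)).re = ‖a‖ ^ 2 := by rw [hωa]; norm_cast
      rw [h5] at h4
      change ‖(‖a‖ : ℂ)⁻¹ • ω (star a * x)‖ ^ 2 ≤ _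
      rw [norm_smul, mul_pow, norm_inv, Complex.norm_real, norm_norm]
      rcases eq_or_ne ‖a‖ 0 with h0 | h0
      · rw [h0]; simpa using h3
      · calc _ ≤ (‖a‖⁻¹) ^ 2 * (‖a‖ ^ 2 * (ω (star x * x)).re) := by gcongr
          _ = _ := by field_simp
    have hψ1 : ‖ψ‖ ≤ 1 := by
      refine ContinuousLinearMap.opNorm_le_bound _ zero_le_one fun x => ?_
      refine le_of_sq_le_sq ?_ (by positivity)
      refine (hψ x).trans ((Complex.re_le_norm _).trans ?_)
      refine (ω.le_of_opNorm_le hω.1 _).trans ?_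
      rw [CStarRing.norm_star_mul_self]; nlinarith
    have hmem : StrongDual.toWeakDual ψ ∈ Prod.fst '' K :=
      ⟨(StrongDual.toWeakDual ψ, StrongDual.toWeakDual ω), ⟨⟨by simpa using hψ1, hω⟩, hψ⟩, rfl⟩
    have := hf _ hmem
    have e : (StrongDual.toWeakDual ψ) a = (‖a‖ : ℂ) := by
      change (‖a‖ : ℂ)⁻¹ • ω (star a * a) = _
      rw [hωa, smul_eq_mul]
      rcases eq_or_ne (‖a‖ : ℂ) 0 with h0 | h0
      · rw [h0]; simp
      · field_simp
    rw [e] at this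
    simpa using this
  have h2 : ((StrongDual.toWeakDual φ) a).re ≤ ‖a‖ := by
    refine (Complex.re_le_norm _).trans ?_
    simpa using φ.le_of_opNorm_le hφ a
  linarith
end States

/-! ### The Arens product through GNS coefficients; the C*-identity on the bidual. -/

section Arens

variable {A : Type u} [NonUnitalCStarAlgebra A]

/-- Every contractive functional is a coefficient of the GNS representation of a quasi-state. -/
theorem exists_hilbert_factorization (φ : StrongDual ℂ A) (hφ : ‖φ‖ ≤ 1) :
    ∃ (H : Type u) (_ : NormedAddCommGroup H) (_ : InnerProductSpace ℂ H) (_ : CompleteSpace H)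
      (Λ T : A →L[ℂ] H) (η : H) (ω : StrongDual ℂ A), ‖ω‖ ≤ 1 ∧ ‖η‖ ≤ 1 ∧
      (∀ a b, ω (a * b) = ⟪Λ (star a), Λ b⟫_ℂ) ∧
      (∀ a b, φ (a * b) = ⟪T (star a), Λ b⟫_ℂ) ∧ ∀ b, φ b = ⟪η, Λ b⟫_ℂ := by
  obtain ⟨ω, hω, hdom⟩ := exists_quasiState_dominating φ hφ
  let := CStarAlgebra.spectralOrder A
  let := CStarAlgebra.spectralOrderedRing A
  let f := toPositiveLinearMap ω hω.2
  -- Domination by `ω` says exactly that `φ` is contractive for the GNS seminorm of `ω`, so it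
  -- descends to the GNS space and is represented there by a vector `η`.
  have hnorm (a : f.PreGNS) : ‖φ (f.ofPreGNS a)‖ ≤ ‖a‖ := by
    rw [f.preGNS_norm_def]
    exact Real.le_sqrt_of_sq_le (hdom _)
  let Λ₀ : A →L[ℂ] f.PreGNS := LinearMap.mkContinuous f.toPreGNS.toLinearMap 1 fun x => by
    rw [f.preGNS_norm_def]
    refine Real.sqrt_le_iff.2 ⟨by positivity, ?_⟩
    change (ω (star x * x)).re ≤ _
    refine (Complex.re_le_norm _).trans ((ω.le_of_opNorm_le hω.1 _).trans ?_)
    rw [CStarRing.norm_star_mul_self]; nlinarith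
  let c : f.PreGNS →L[ℂ] f.GNS := UniformSpace.Completion.toComplL
  let ψ₀ : f.PreGNS →L[ℂ] ℂ := LinearMap.mkContinuous (φ.toLinearMap ∘ₗ f.ofPreGNS.toLinearMap) 1
    fun x => by simpa using hnorm x
  let ψ : f.GNS →L[ℂ] ℂ := ψ₀.extend c
  have hd : DenseRange c := UniformSpace.Completion.denseRange_coe
  have hu : IsUniformInducing c := UniformSpace.Completion.isUniformInducing_coe _
  have hψ (x : f.PreGNS) : ψ (c x) = ψ₀ x := ContinuousLinearMap.extend_eq _ hd hu x
  have hψn : ‖ψ‖ ≤ 1 := by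
    refine ContinuousLinearMap.opNorm_le_bound _ zero_le_one fun x => ?_
    refine UniformSpace.Completion.induction_on x (isClosed_le (by fun_prop) (by fun_prop)) fun a => ?_
    have := hψ a
    change ‖ψ (c a)‖ ≤ _
    rw [this, one_mul, UniformSpace.Completion.norm_coe]
    exact hnorm a
  let η : f.GNS := (InnerProductSpace.toDual ℂ f.GNS).symm ψ
  have hη (x : f.GNS) : ⟪η, x⟫_ℂ = ψ x := InnerProductSpace.toDual_symm_apply
  have hφη (b : A) : φ b = ⟪η, c (Λ₀ b)⟫_ℂ := by rw [hη, hψ]; rfl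
  let π := f.gnsNonUnitalStarAlgHom
  have hπ (a b : A) : π a (c (Λ₀ b)) = c (Λ₀ (a * b)) := f.gnsNonUnitalStarAlgHom_apply_coe
  -- Chosen as `a ↦ π(a) η`, so that `φ(a b) = ⟨η, π(a) Λ b⟩ = ⟨T(a*), Λ b⟩`.
  let T : A →L[ℂ] f.GNS := LinearMap.mkContinuous
    { toFun := fun a => π a η
      map_add' := fun a b => by simp
      map_smul' := fun z a => by simp } ‖η‖ fun a => by
        refine ((π a).le_opNorm η).trans ?_
        rw [mul_comm]
        gcongr
        exact NonUnitalStarAlgHom.norm_apply_le π a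
  refine ⟨f.GNS, inferInstance, inferInstance, inferInstance, c.comp Λ₀, T, η, ω, hω.1, ?_, ?_, ?_,
    hφη⟩
  · simpa [η] using hψn
  · intro a b
    change _ = ⟪((Λ₀ (star a) : f.PreGNS) : f.GNS), ((Λ₀ b : f.PreGNS) : f.GNS)⟫_ℂ
    rw [UniformSpace.Completion.inner_coe, f.preGNS_inner_def]
    change _ = ω (star (star a) * b)
    rw [star_star]
  · intro a b
    rw [hφη, ← hπ]
    change _ = ⟪π (star a) η, c (Λ₀ b)⟫_ℂ
    rw [map_star, ContinuousLinearMap.star_eq_adjoint, ContinuousLinearMap.adjoint_inner_left]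

section Extend

variable {H : Type*} [NormedAddCommGroup H] [InnerProductSpace ℂ H] [CompleteSpace H]

/-- The extension `A'' → H` of a bounded operator `A → H` into a Hilbert space. -/
def bidualExtend (Λ : A →L[ℂ] H) (Ψ : StrongDual ℂ (StrongDual ℂ A)) : H :=
  (InnerProductSpace.toDual ℂ H).symm
    (((starL ℂ : ℂ ≃L⋆[ℂ] ℂ) : ℂ →L⋆[ℂ] ℂ).comp
      ((Ψ.comp (ContinuousLinearMap.precomp ℂ Λ)).comp (innerSL ℂ)))

theorem inner_bidualExtend (Λ : A →L[ℂ] H) (Ψ : StrongDual ℂ (StrongDual ℂ A)) (h : H) :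
    ⟪h, bidualExtend Λ Ψ⟫_ℂ = Ψ ((innerSL ℂ h).comp Λ) := by
  rw [← inner_conj_symm, bidualExtend, InnerProductSpace.toDual_symm_apply]
  exact star_star _

theorem bidual_star_star (Φ : StrongDual ℂ (StrongDual ℂ A)) :
    (bidual A).star ((bidual A).star Φ) = Φ := by
  ext φ
  rw [bidual_star_apply, bidual_star_apply, star_star]
  congr 1
  ext a
  simp [dualStar_apply]

/-- A coefficient formula for the Arens product. -/
theorem bidual_mul_apply_eq_inner (φ : StrongDual ℂ A) (Λ T : A →L[ℂ] H)
    (h : ∀ a b, φ (a * b) = ⟪T (star a), Λ b⟫_ℂ) (Φ Ψ : StrongDual ℂ (StrongDual ℂ A)) :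
    (bidual A).mul Φ Ψ φ = ⟪bidualExtend T ((bidual A).star Φ), bidualExtend Λ Ψ⟫_ℂ := by
  rw [bidual_mul_apply, ← inner_conj_symm, inner_bidualExtend, bidual_star_apply]
  -- For fixed `a`, the functional `b ↦ φ(a b)` is a coefficient of `Λ`; applying `Ψ` replaces `Λ b`
  -- by the extended vector and leaves a coefficient of `T` in the variable `a`.
  have : arensAct Ψ φ = dualStar ((innerSL ℂ (bidualExtend Λ Ψ)).comp T) := by
    ext a
    rw [arensAct_apply, dualStar_apply]
    have e : φ.comp (ContinuousLinearMap.mul ℂ A a) = (innerSL ℂ (T (star a))).comp Λ := by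
      ext b; exact h a b
    rw [e, ← inner_bidualExtend]
    exact (inner_conj_symm _ _).symm
  rw [this]
  exact (star_star _).symm

end Extend

/-- This is Arens regularity. Passing from `φ` to `dualStar φ` interchanges `Λ` and `T` in the
coefficient formula, so both sides are conjugate inner products of the same two vectors. -/
theorem bidual_star_mul (Φ Ψ : StrongDual ℂ (StrongDual ℂ A)) :
    (bidual A).star ((bidual A).mul Φ Ψ) =
      (bidual A).mul ((bidual A).star Ψ) ((bidual A).star Φ) := by
  suffices h : ∀ φ : StrongDual ℂ A, ‖φ‖ ≤ 1 → (bidual A).star ((bidual A).mul Φ Ψ) φ =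
      (bidual A).mul ((bidual A).star Ψ) ((bidual A).star Φ) φ by
    ext φ
    -- Scaling by `‖φ‖ + 1` instead of `‖φ‖` keeps the factor invertible when `φ = 0`.
    have h1 := h (((‖φ‖ : ℂ) + 1)⁻¹ • φ) ?_
    · rw [map_smul, map_smul] at h1
      refine smul_right_injective ℂ (inv_ne_zero ?_) h1
      norm_cast; positivity
    · rw [norm_smul, norm_inv]
      have : ‖(‖φ‖ : ℂ) + 1‖ = ‖φ‖ + 1 := by
        norm_cast; exact Real.norm_of_nonneg (by positivity)
      rw [this, inv_mul_le_iff₀ (by positivity)]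
      linarith
  intro φ hφ
  obtain ⟨H, _, _, _, Λ, T, η, ω, -, -, -, hT, -⟩ := exists_hilbert_factorization φ hφ
  have hs (a b : A) : dualStar φ (a * b) = ⟪Λ (star a), T b⟫_ℂ := by
    rw [dualStar_apply, star_mul, hT, star_star]
    exact inner_conj_symm _ _
  rw [bidual_star_apply, bidual_mul_apply_eq_inner _ T Λ hs, bidual_mul_apply_eq_inner _ Λ T hT,
    bidual_star_star]
  exact inner_conj_symm _ _

theorem norm_arensAct_le (Φ : StrongDual ℂ (StrongDual ℂ A)) (φ : StrongDual ℂ A) :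
    ‖arensAct Φ φ‖ ≤ ‖Φ‖ * ‖φ‖ := by
  refine ContinuousLinearMap.opNorm_le_bound _ (by positivity) fun a => ?_
  rw [arensAct_apply]
  refine (Φ.le_opNorm _).trans ?_
  rw [mul_assoc]
  gcongr
  refine (ContinuousLinearMap.opNorm_comp_le _ _).trans ?_
  gcongr
  exact ContinuousLinearMap.opNorm_mul_apply_le ℂ A a

theorem bidual_norm_mul_le (Φ Ψ : StrongDual ℂ (StrongDual ℂ A)) :
    ‖(bidual A).mul Φ Ψ‖ ≤ ‖Φ‖ * ‖Ψ‖ := by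
  refine ContinuousLinearMap.opNorm_le_bound _ (by positivity) fun φ => ?_
  rw [bidual_mul_apply]
  refine (Φ.le_opNorm _).trans ?_
  rw [mul_assoc]
  gcongr
  exact norm_arensAct_le Ψ φ

theorem bidual_norm_star_le (Φ : StrongDual ℂ (StrongDual ℂ A)) :
    ‖(bidual A).star Φ‖ ≤ ‖Φ‖ := by
  refine ContinuousLinearMap.opNorm_le_bound _ (by positivity) fun φ => ?_
  rw [bidual_star_apply, norm_star]
  refine (Φ.le_opNorm _).trans ?_
  gcongr
  refine ContinuousLinearMap.opNorm_le_bound _ (norm_nonneg _) fun a => ?_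
  rw [dualStar_apply, norm_star]
  exact (φ.le_opNorm _).trans_eq (by rw [norm_star])

/-- For the lower bound, let `v` be the image of `Φ` in the GNS space of the quasi-state `ω` that
dominates `φ`. Then `Φ φ = ⟨η, v⟩`, while `‖v‖² = (Φ* Φ)(ω) ≤ ‖Φ* Φ‖`. -/
theorem bidual_norm_star_mul_self (Φ : StrongDual ℂ (StrongDual ℂ A)) :
    ‖(bidual A).mul ((bidual A).star Φ) Φ‖ = ‖Φ‖ * ‖Φ‖ := by
  refine le_antisymm ?_ ?_
  · refine (bidual_norm_mul_le _ _).trans ?_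
    gcongr
    exact bidual_norm_star_le Φ
  set Θ := (bidual A).mul ((bidual A).star Φ) Φ with hΘ
  suffices h : ‖Φ‖ ≤ √‖Θ‖ by
    calc ‖Φ‖ * ‖Φ‖ ≤ √‖Θ‖ * √‖Θ‖ := by gcongr
      _ = ‖Θ‖ := Real.mul_self_sqrt (norm_nonneg _)
  refine ContinuousLinearMap.opNorm_le_of_unit_norm (Real.sqrt_nonneg _) fun φ hφ => ?_
  obtain ⟨H, _, _, _, Λ, T, η, ω, hω, hη, hΛ, -, hφη⟩ := exists_hilbert_factorization φ hφ.le
  have h1 : Θ ω = (‖bidualExtend Λ Φ‖ : ℂ) ^ 2 := by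
    rw [hΘ, bidual_mul_apply_eq_inner _ Λ Λ hΛ, bidual_star_star]
    exact inner_self_eq_norm_sq_to_K _
  have h2 : ‖bidualExtend Λ Φ‖ ^ 2 ≤ ‖Θ‖ := by
    have h3 : ‖Θ ω‖ ≤ ‖Θ‖ * 1 := (Θ.le_opNorm ω).trans (by gcongr)
    rw [h1, norm_pow, Complex.norm_real, norm_norm, mul_one] at h3
    exact h3
  have h4 : Φ φ = ⟪η, bidualExtend Λ Φ⟫_ℂ := by
    rw [inner_bidualExtend]
    congr 1
    ext b; exact hφη b
  rw [h4]
  refine (norm_inner_le_norm _ _).trans ?_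
  calc ‖η‖ * ‖bidualExtend Λ Φ‖ ≤ 1 * ‖bidualExtend Λ Φ‖ := by gcongr
    _ ≤ _ := by rw [one_mul]; exact Real.le_sqrt_of_sq_le h2

end Arens

/-- Bounded families in a dual space converge pointwise along ultrafilters. -/
theorem exists_ultralimit {E : Type*} [NormedAddCommGroup E] [NormedSpace ℂ E] {ι : Type*}
    (𝒰 : Ultrafilter ι) (x : ι → StrongDual ℂ E) (C : ℝ) (h : ∀ᶠ i in 𝒰, ‖x i‖ ≤ C) :
    ∃ y : StrongDual ℂ E, ‖y‖ ≤ C ∧ ∀ φ, Tendsto (fun i => x i φ) 𝒰 (𝓝 (y φ)) := by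
  have hc := WeakDual.isCompact_closedBall (𝕜 := ℂ) (0 : StrongDual ℂ E) C
  obtain ⟨y, hy, hle⟩ := hc.ultrafilter_le_nhds (𝒰.map fun i => StrongDual.toWeakDual (x i)) (by
    rw [le_principal_iff, Ultrafilter.coe_map, mem_map]
    filter_upwards [h] with i hi
    simpa using hi)
  refine ⟨WeakDual.toStrongDual y, by simpa using hy, fun φ => ?_⟩
  have h2 : Tendsto (fun i => StrongDual.toWeakDual (x i)) 𝒰 (𝓝 y) := hle
  exact ((WeakDual.eval_continuous φ).tendsto y).comp h2

/-! ### The W*-algebra structure of the bidual and the biduals of ideals. -/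

section Bidual

variable {A : Type u} [NonUnitalCStarAlgebra A]

theorem bidual_mul_assoc (x y z : StrongDual ℂ (StrongDual ℂ A)) :
    (bidual A).mul ((bidual A).mul x y) z = (bidual A).mul x ((bidual A).mul y z) := by
  ext φ
  simp only [bidual_mul_apply]
  congr 1
  ext a
  simp only [arensAct_apply, bidual_mul_apply]
  congr 1
  ext b
  simp only [arensAct_apply, ContinuousLinearMap.comp_apply, ContinuousLinearMap.mul_apply']
  congr 1
  ext c
  simp [mul_assoc]

theorem arensAct_add (x y : StrongDual ℂ (StrongDual ℂ A)) (φ : StrongDual ℂ A) :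
    arensAct (x + y) φ = arensAct x φ + arensAct y φ := rfl

theorem arensAct_smul (c : ℂ) (x : StrongDual ℂ (StrongDual ℂ A)) (φ : StrongDual ℂ A) :
    arensAct (c • x) φ = c • arensAct x φ := rfl

/-- The unit is a weak-* limit of an approximate unit along an ultrafilter. With this Arens product
only the right-hand law is immediate. -/
theorem exists_bidual_right_one (A : Type u) [NonUnitalCStarAlgebra A] :
    ∃ e, ∀ x, (bidual A).mul x e = x := by
  let := CStarAlgebra.spectralOrder A
  let := CStarAlgebra.spectralOrderedRing A
  have hl := CStarAlgebra.increasingApproximateUnit A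
  let 𝒰 : Ultrafilter A := Ultrafilter.of (CStarAlgebra.approximateUnit A)
  have h𝒰 : (𝒰 : Filter A) ≤ CStarAlgebra.approximateUnit A := Ultrafilter.of_le _
  obtain ⟨e, -, he⟩ := exists_ultralimit 𝒰
    (fun a => NormedSpace.inclusionInDoubleDual ℂ A a) 1 (by
      filter_upwards [h𝒰 hl.eventually_norm] with a ha
      exact (NormedSpace.double_dual_bound ℂ A a).trans ha)
  refine ⟨e, fun x => ?_⟩
  ext φ
  rw [bidual_mul_apply]
  congr 1
  ext a
  rw [arensAct_apply]
  refine tendsto_nhds_unique (he _) ?_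
  have h1 := (hl.tendsto_mul_left a).mono_left h𝒰
  exact (φ.continuous.tendsto a).comp h1

/-- If `e` is a right unit, then `e*` is a left unit because the involution reverses products; hence
`e* = e* e = e`. -/
theorem exists_bidual_one (A : Type u) [NonUnitalCStarAlgebra A] :
    ∃ e, ∀ x, (bidual A).mul e x = x ∧ (bidual A).mul x e = x := by
  obtain ⟨e, he⟩ := exists_bidual_right_one A
  have hl (x) : (bidual A).mul ((bidual A).star e) x = x := by
    have := congrArg (bidual A).star (he ((bidual A).star x))
    rwa [bidual_star_mul, bidual_star_star] at this
  have hee : (bidual A).star e = e := (he _).symm.trans (hl e)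
  rw [hee] at hl
  exact ⟨e, fun x => ⟨hl x, he x⟩⟩

/-- The bidual of a C*-algebra is a W*-algebra. -/
theorem bidual_isWStarAlgebra (A : Type u) [NonUnitalCStarAlgebra A] :
    (bidual A).IsWStarAlgebra where
  complete := inferInstance
  mul_assoc := bidual_mul_assoc
  add_mul _ _ _ := rfl
  mul_add x y z := by
    ext φ
    change x (arensAct (y + z) φ) = _
    rw [arensAct_add, map_add]
    rfl
  smul_mul _ _ _ := rfl
  mul_smul c x y := by
    ext φ
    change x (arensAct (c • y) φ) = _
    rw [arensAct_smul, map_smul]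
    rfl
  exists_one := exists_bidual_one A
  star_star := bidual_star_star
  star_add x y := by
    ext φ
    simp only [bidual_star_apply, add_apply, star_add]
  star_smul c x := by
    ext φ
    simp only [bidual_star_apply, smul_apply, star_smul]
    rfl
  star_mul := bidual_star_mul
  norm_mul_le := bidual_norm_mul_le
  norm_star_mul_self := bidual_norm_star_mul_self

variable {B : Type w} [NonUnitalCStarAlgebra B]

theorem bidualMap_mul (f : A →L[ℂ] B) (hf : ∀ a b, f (a * b) = f a * f b)
    (x y : StrongDual ℂ (StrongDual ℂ A)) :
    bidualMap f ((bidual A).mul x y) = (bidual B).mul (bidualMap f x) (bidualMap f y) := by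
  ext φ
  rw [bidualMap_apply, bidual_mul_apply, bidual_mul_apply, bidualMap_apply]
  congr 1
  ext a
  simp only [arensAct_apply, bidualMap_apply, ContinuousLinearMap.comp_apply]
  congr 1
  ext b
  simp [hf]

theorem bidualMap_star (f : A →L[ℂ] B) (hf : ∀ a, f (star a) = star (f a))
    (x : StrongDual ℂ (StrongDual ℂ A)) :
    bidualMap f ((bidual A).star x) = (bidual B).star (bidualMap f x) := by
  ext φ
  rw [bidualMap_apply, bidual_star_apply, bidual_star_apply, bidualMap_apply]
  congr 2
  ext a
  simp [dualStar_apply, hf]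

theorem continuous_wstar_iff {X E : Type*} [NormedAddCommGroup E] [NormedSpace ℂ E]
    (τ : TopologicalSpace X) (f : X → StrongDual ℂ E) :
    Continuous[τ, wstar E] f ↔ ∀ φ, Continuous[τ, _] fun x => f x φ := by
  rw [continuous_induced_rng]
  constructor
  · intro h φ
    exact (WeakDual.eval_continuous φ).comp h
  · intro h
    exact WeakDual.continuous_of_continuous_eval h

theorem continuous_wstar_eval {E : Type*} [NormedAddCommGroup E] [NormedSpace ℂ E] (φ : E) :
    Continuous[wstar E, _] fun x : StrongDual ℂ E => x φ := by
  let := wstar E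
  exact (WeakDual.eval_continuous (𝕜 := ℂ) φ).comp
    (continuous_induced_dom (f := fun x : StrongDual ℂ E => StrongDual.toWeakDual x))

theorem continuous_wstar_bidualMap {E F : Type*} [NormedAddCommGroup E] [NormedSpace ℂ E]
    [NormedAddCommGroup F] [NormedSpace ℂ F] (f : E →L[ℂ] F) :
    Continuous[wstar (StrongDual ℂ E), wstar (StrongDual ℂ F)] (bidualMap f) := by
  rw [continuous_wstar_iff]
  intro φ
  exact continuous_wstar_eval (φ.comp f)

theorem isClosed_wstar_eval_eq_zero {E : Type*} [NormedAddCommGroup E] [NormedSpace ℂ E] (φ : E) :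
    IsClosed[wstar E] {x : StrongDual ℂ E | x φ = 0} := by
  let := wstar E
  exact isClosed_eq (continuous_wstar_eval φ) continuous_const

/-- A subspace of a dual space with trivial pre-annihilator is weak-* dense. -/
theorem wstar_closure_eq_univ {E : Type*} [NormedAddCommGroup E] [NormedSpace ℂ E]
    (W : Submodule ℂ (StrongDual ℂ E)) (h : ∀ φ : E, (∀ x ∈ W, x φ = 0) → φ = 0) :
    @closure _ (wstar E) (W : Set (StrongDual ℂ E)) = Set.univ := by
  let W' : Submodule ℂ (WeakDual ℂ E) := W.map StrongDual.toWeakDual.toLinearMap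
  have hW' : (W' : Set (WeakDual ℂ E)) = StrongDual.toWeakDual '' (W : Set _) := rfl
  let := wstar E
  have hind : Topology.IsInducing fun x : StrongDual ℂ E => StrongDual.toWeakDual x := ⟨rfl⟩
  rw [hind.closure_eq_preimage_closure_image, ← hW', Set.eq_univ_iff_forall]
  intro x
  change StrongDual.toWeakDual x ∈ W'.topologicalClosure
  by_contra hx
  have hconv : Convex ℝ (W'.topologicalClosure : Set (WeakDual ℂ E)) := by
    intro a ha b hb s t _ _ _
    have h1 := W'.topologicalClosure.smul_mem (s : ℂ) ha
    have h2 := W'.topologicalClosure.smul_mem (t : ℂ) hb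
    exact W'.topologicalClosure.add_mem h1 h2
  obtain ⟨φ, c, h1, h2⟩ := exists_eval_separating hconv W'.isClosed_topologicalClosure hx
  have hφ : φ = 0 := by
    refine h φ fun y hy => ?_
    by_contra hne
    have hy' (z : ℂ) : z • StrongDual.toWeakDual y ∈ W'.topologicalClosure :=
      W'.topologicalClosure.smul_mem z (W'.le_topologicalClosure ⟨y, hy, rfl⟩)
    have h3 := h1 _ (hy' ((c : ℂ) * (y φ)⁻¹))
    have e : (((c : ℂ) * (y φ)⁻¹) • StrongDual.toWeakDual y) φ = c := by
      change ((c : ℂ) * (y φ)⁻¹) • y φ = c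
      rw [smul_eq_mul]; field_simp
    rw [e] at h3
    simp at h3
  subst hφ
  have h3 := h1 _ W'.topologicalClosure.zero_mem
  simp at h3 h2
  linarith

namespace CStarIdeal

variable (J : CStarIdeal A)

/-- An element vanishing on the annihilator of `J` depends only on restrictions to `J`. Evaluating
it on norm-preserving extensions therefore defines a bounded functional on `J'`. -/
theorem mem_bidualRange_iff {x : StrongDual ℂ (StrongDual ℂ A)} :
    x ∈ J.bidualRange ↔ ∀ φ : StrongDual ℂ A, (∀ a ∈ J.alg, φ a = 0) → x φ = 0 := by
  constructor
  · rintro ⟨y, rfl⟩ φ hφ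
    change y (φ.comp J.incl) = 0
    have : φ.comp J.incl = 0 := by ext a; exact hφ a a.2
    rw [this, map_zero]
  · intro h
    have hext (φ : StrongDual ℂ J.alg) : ∃ g : StrongDual ℂ A, g.comp J.incl = φ ∧ ‖g‖ = ‖φ‖ := by
      obtain ⟨g, hg, hn⟩ := exists_extension_norm_eq J.alg.toSubmodule φ
      exact ⟨g, by ext x; exact hg x, hn⟩
    choose g hg hn using hext
    have hx (φ ψ : StrongDual ℂ A) (e : φ.comp J.incl = ψ.comp J.incl) : x φ = x ψ := by
      rw [← sub_eq_zero, ← map_sub]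
      refine h _ fun a ha => ?_
      have := DFunLike.congr_fun e ⟨a, ha⟩
      exact sub_eq_zero.2 this
    refine ⟨LinearMap.mkContinuous
      { toFun := fun φ => x (g φ)
        map_add' := fun φ ψ => by
          rw [← map_add]
          exact hx _ _ (by rw [hg, ContinuousLinearMap.add_comp, hg, hg])
        map_smul' := fun c φ => by
          rw [RingHom.id_apply, ← map_smul]
          exact hx _ _ (by rw [hg, ContinuousLinearMap.smul_comp, hg]) } ‖x‖ fun φ => by
        refine (x.le_opNorm _).trans_eq ?_
        rw [hn], ?_⟩
    ext φ
    exact hx _ _ (hg _)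

theorem bidualIncl_mul (x y : StrongDual ℂ (StrongDual ℂ J.alg)) :
    J.bidualIncl ((_root_.bidual J.alg).mul x y) =
      (_root_.bidual A).mul (J.bidualIncl x) (J.bidualIncl y) :=
  bidualMap_mul J.incl (fun _ _ => rfl) x y

theorem bidualIncl_star (x : StrongDual ℂ (StrongDual ℂ J.alg)) :
    J.bidualIncl ((_root_.bidual J.alg).star x) = (_root_.bidual A).star (J.bidualIncl x) :=
  bidualMap_star J.incl (fun _ => rfl) x

theorem isWStarIdeal_bidualRange : (_root_.bidual A).IsWStarIdeal J.bidualRange where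
  mul_mem_left a x hx := by
    rw [mem_bidualRange_iff] at hx ⊢
    intro φ hφ
    rw [bidual_mul_apply]
    have : arensAct x φ = 0 := by
      ext b
      rw [arensAct_apply]
      exact hx _ fun c hc => hφ _ (J.mul_mem_left b c hc)
    rw [this, map_zero]
  mul_mem_right a x hx := by
    rw [mem_bidualRange_iff] at hx ⊢
    intro φ hφ
    rw [bidual_mul_apply]
    refine hx _ fun b hb => ?_
    rw [arensAct_apply]
    have : φ.comp (ContinuousLinearMap.mul ℂ A b) = 0 := by
      ext c
      exact hφ _ (J.mul_mem_right c b hb)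
    rw [this, map_zero]
  star_mem := by
    rintro _ ⟨y, rfl⟩
    exact ⟨_, J.bidualIncl_star y⟩
  isClosed := by
    have : (J.bidualRange : Set (StrongDual ℂ (StrongDual ℂ A))) =
        ⋂ (φ : StrongDual ℂ A) (_ : ∀ a ∈ J.alg, φ a = 0), {x | x φ = 0} := by
      ext x
      simp only [SetLike.mem_coe, mem_bidualRange_iff, Set.mem_iInter]
      rfl
    rw [this]
    let := wstar (StrongDual ℂ A)
    exact isClosed_iInter fun φ => isClosed_iInter fun _ => isClosed_wstar_eval_eq_zero φ

/-- The weak-* topology of `J''` is the induced one because every functional on `J` extends to `A`.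
-/
theorem isEmbedding_bidualIncl :
    @Topology.IsEmbedding _ _ (wstar (StrongDual ℂ J.alg)) (wstar (StrongDual ℂ A))
      J.bidualIncl := by
  let := wstar (StrongDual ℂ J.alg)
  let := wstar (StrongDual ℂ A)
  refine ⟨⟨le_antisymm ?_ ?_⟩, J.bidualIncl_injective⟩
  · exact (continuous_wstar_bidualMap J.incl).le_induced
  · rw [← continuous_id_iff_le]
    refine (continuous_wstar_iff _ _).2 ?_
    intro φ
    obtain ⟨g, hg, -⟩ := exists_extension_norm_eq J.alg.toSubmodule φ
    have e : g.comp J.incl = φ := by ext x; exact hg x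
    subst e
    exact @Continuous.comp _ _ _ (TopologicalSpace.induced J.bidualIncl (wstar (StrongDual ℂ A)))
      (wstar (StrongDual ℂ A)) _ _ _ (continuous_wstar_eval g) continuous_induced_dom

/-- If `x` annihilates `I^⊥` and `J^⊥`, it annihilates `(I ∩ J)^⊥`. -/
theorem apply_eq_zero_of_mem_bidualRange (I J : CStarIdeal A)
    {x : StrongDual ℂ (StrongDual ℂ A)} (hI : x ∈ I.bidualRange) (hJ : x ∈ J.bidualRange)
    (φ : StrongDual ℂ A) (hφ : ∀ a ∈ I.alg, a ∈ J.alg → φ a = 0) : x φ = 0 := by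
  obtain ⟨e, he⟩ := exists_bidual_one J.alg
  -- With `x = x e`, the value `x φ` is `x` applied to `a ↦ e(b ↦ φ(a b))`. This functional vanishes
  -- on `I`, since `a b ∈ I ∩ J` for `a ∈ I` and `b ∈ J`.
  have hx : (_root_.bidual A).mul x (J.bidualIncl e) = x := by
    obtain ⟨y, rfl⟩ := hJ
    rw [← bidualIncl_mul, (he y).2]
  rw [← hx, bidual_mul_apply]
  rw [mem_bidualRange_iff] at hI
  refine hI _ fun a ha => ?_
  rw [arensAct_apply]
  have : J.bidualIncl e ∈ J.bidualRange := ⟨e, rfl⟩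
  rw [mem_bidualRange_iff] at this
  exact this _ fun b hb => hφ _ (I.mul_mem_right b a ha) (J.mul_mem_left a b hb)

end CStarIdeal

end Bidual

/-! ### Partial actions obtained by restricting a global W*-action. -/

section FormalEnveloping

variable {G : Type v} [Group G] {E : Type u} [NormedAddCommGroup E] [NormedSpace ℂ E]
  {F : Type w} [NormedAddCommGroup F] [NormedSpace ℂ F]

/-- A family of maps between W*-ideals of `M` that corresponds to the restriction of a global
W*-action under an embedding `ι` of `M` as an ideal is a W*-partial action. -/
theorem IsWStarPartialAction.of_embedding {M : DualStarAlgebra E}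
    {γ : PartialFamily G (StrongDual ℂ E)} {N : DualStarAlgebra F}
    {σ : G → StrongDual ℂ F →ₗ[ℂ] StrongDual ℂ F} {ι : StrongDual ℂ E →ₗ[ℂ] StrongDual ℂ F}
    (hM : M.IsWStarAlgebra) (hγ : ∀ t, M.IsWStarIdeal (γ.dom t)) (hσ : IsWStarAction N σ)
    (map_mul : ∀ x y, ι (M.mul x y) = N.mul (ι x) (ι y))
    (map_star : ∀ x, ι (M.star x) = N.star (ι x))
    (hι : @Topology.IsEmbedding _ _ (wstar E) (wstar F) ι)
    (map_dom : ∀ t, ι '' (γ.dom t) = Set.range ι ∩ σ t '' Set.range ι)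
    (map_act : ∀ (t : G) (x : γ.dom t⁻¹), ι (γ.act t x) = σ t (ι x)) :
    IsWStarPartialAction M γ := by
  have inj : Function.Injective ι := by
    let := wstar E
    let := wstar F
    exact hι.injective
  -- The domain of `γ_t` consists of the points that `σ_t` keeps inside `ι(M)`. With `ι` injective,
  -- every axiom can then be checked in `N`.
  have mem_iff (t : G) (x : StrongDual ℂ E) : x ∈ γ.dom t⁻¹ ↔ ∃ y, ι y = σ t (ι x) := by
    have h1 : x ∈ γ.dom t⁻¹ ↔ ι x ∈ ι '' (γ.dom t⁻¹) :=
      ⟨fun h => ⟨x, h, rfl⟩, fun ⟨y, hy, e⟩ => inj e ▸ hy⟩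
    rw [h1, map_dom]
    constructor
    · rintro ⟨-, -, ⟨y, rfl⟩, h⟩
      refine ⟨y, ?_⟩
      rw [← h, ← hσ.act_mul, mul_inv_cancel, hσ.act_one]
    · rintro ⟨y, h⟩
      refine ⟨⟨x, rfl⟩, ι y, ⟨y, rfl⟩, ?_⟩
      rw [h, ← hσ.act_mul, inv_mul_cancel, hσ.act_one]
  have σinj (t : G) : Function.Injective (σ t) := fun x y h => by
    have := congrArg (σ t⁻¹) h
    rwa [← hσ.act_mul, ← hσ.act_mul, inv_mul_cancel, hσ.act_one, hσ.act_one] at this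
  refine
    { isWStarAlgebra := hM
      ideal := hγ
      bijective := fun t => ⟨fun x y h => ?_, fun y => ?_⟩
      map_mul := fun t x y z h => inj ?_
      map_star := fun t x z h => inj ?_
      wstar_continuous := fun t => ?_
      dom_one := ?_
      act_one := fun x => inj ?_
      act_mul := fun s t x h => ?_ }
  · have := congrArg (fun z : γ.dom t => ι (z : StrongDual ℂ E)) h
    simp only [map_act] at this
    exact Subtype.ext (inj (σinj t this))
  · have : ι y ∈ ι '' (γ.dom t) := ⟨y, y.2, rfl⟩
    rw [map_dom] at this
    obtain ⟨-, -, ⟨w, rfl⟩, hw⟩ := this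
    refine ⟨⟨w, (mem_iff t w).2 ⟨y, hw.symm⟩⟩, Subtype.ext (inj ?_)⟩
    rw [map_act, hw]
  · rw [map_act, h, map_mul, hσ.map_mul, map_mul, map_act, map_act]
  · rw [map_act, h, map_star, hσ.map_star, map_star, map_act]
  · let := wstar E
    let := wstar F
    rw [hι.isInducing.continuous_iff]
    have : (ι ∘ fun x : γ.dom t⁻¹ => (γ.act t x : StrongDual ℂ E)) =
        fun x : γ.dom t⁻¹ => σ t (ι x) :=
      funext (map_act t)
    rw [this]
    exact (hσ.wstar_continuous t).comp (hι.continuous.comp continuous_induced_dom)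
  · rw [eq_top_iff]
    intro x _
    have : x ∈ γ.dom (1 : G)⁻¹ := (mem_iff 1 x).2 ⟨x, (hσ.act_one _).symm⟩
    rwa [inv_one] at this
  · rw [map_act, hσ.act_one]
  · obtain ⟨y, hy⟩ := (mem_iff s _).1 h
    have h' : (x : StrongDual ℂ E) ∈ γ.dom (s * t)⁻¹ :=
      (mem_iff _ _).2 ⟨y, by rw [hy, map_act, hσ.act_mul]⟩
    exact ⟨h', inj (by rw [map_act, map_act, map_act, hσ.act_mul])⟩

end FormalEnveloping

/-! ### Part (1): the bidual of a C*-enveloping action is W*-enveloping. -/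

section BidualEnveloping

variable {A : Type u} [NonUnitalCStarAlgebra A] {G : Type v} [Group G]

theorem bidualAction_isWStarAction (β : G →* (A ≃⋆ₐ[ℂ] A)) :
    IsWStarAction (bidual A) (bidualAction β) where
  isWStarAlgebra := bidual_isWStarAlgebra A
  map_mul t := bidualMap_mul (starIsoL (β t)) (map_mul (β t))
  map_star t := bidualMap_star (starIsoL (β t)) (map_star (β t))
  wstar_continuous t := continuous_wstar_bidualMap (starIsoL (β t))
  act_one x := by
    have : starIsoL (β 1) = ContinuousLinearMap.id ℂ A := by ext a; simp [starIsoL]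
    change bidualMap (starIsoL (β 1)) x = x
    rw [this]
    rfl
  act_mul s t x := by
    have : starIsoL (β (s * t)) = (starIsoL (β s)).comp (starIsoL (β t)) := by
      ext a; simp [starIsoL]
    change bidualMap (starIsoL (β (s * t))) x = _
    rw [this]
    rfl

theorem CStarPartialAction.bidual_act_bidualIncl (α : CStarPartialAction G A) (t : G)
    (x : α.bidual.dom t⁻¹) (y : StrongDual ℂ (StrongDual ℂ (α.dom t⁻¹).alg))
    (h : (α.dom t⁻¹).bidualIncl y = x) :
    (α.bidual.act t x : StrongDual ℂ (StrongDual ℂ A)) =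
      (α.dom t).bidualIncl (bidualMap (starIsoL (α.act t)) y) := by
  have : (α.dom t⁻¹).bidualEquiv.symm x = y :=
    (LinearEquiv.symm_apply_eq (α.dom t⁻¹).bidualEquiv).2 (Subtype.ext h.symm)
  exact congrArg (fun z => (α.dom t).bidualIncl (bidualMap (starIsoL (α.act t)) z)) this

variable {B : Type u} [NonUnitalCStarAlgebra B] (β : G →* (B ≃⋆ₐ[ℂ] B)) (A : CStarIdeal B)

/-- The ideal `β_t(A)` of `B`. -/
def translateIdeal (t : G) : CStarIdeal B where
  alg := A.alg.comap (β t⁻¹ : B →⋆ₙₐ[ℂ] B)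
  isClosed := A.isClosed.preimage (StarAlgEquiv.isometry (β t⁻¹)).continuous
  mul_mem_left a x hx := by
    change β t⁻¹ (a * x) ∈ A.alg
    rw [map_mul]
    exact A.mul_mem_left _ _ hx
  mul_mem_right a x hx := by
    change β t⁻¹ (x * a) ∈ A.alg
    rw [map_mul]
    exact A.mul_mem_right _ _ hx

/-- One inclusion is functoriality of the double transpose. For the other, an element of the
intersection lies in the biduals of both `A` and `β_t(A)`, hence kills every functional vanishing on
`A ∩ β_t(A)`. -/
theorem bidualIncl_image_restrictDom (t : G) :
    A.bidualIncl '' (restrictDom β A t).bidualRange =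
      Set.range A.bidualIncl ∩ bidualAction β t '' Set.range A.bidualIncl := by
  refine Set.Subset.antisymm ?_ ?_
  · rintro _ ⟨_, ⟨y, rfl⟩, rfl⟩
    refine ⟨⟨_, rfl⟩, _, ⟨(restrictDom β A t⁻¹).bidualIncl
      (bidualMap (starIsoL (restrictAct β A t).symm) y), rfl⟩, ?_⟩
    change bidualMap (((starIsoL (β t)).comp (A.incl.comp (restrictDom β A t⁻¹).incl)).comp
      (starIsoL (restrictAct β A t).symm)) y = bidualMap (A.incl.comp (restrictDom β A t).incl) y
    congr 2
    ext x
    exact act_apply_inv β t _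
  · rintro _ ⟨⟨x, rfl⟩, _, ⟨w, rfl⟩, h⟩
    refine ⟨x, ?_, rfl⟩
    refine (CStarIdeal.mem_bidualRange_iff _).2 fun φ hφ => ?_
    obtain ⟨g, hg, -⟩ := exists_extension_norm_eq A.alg.toSubmodule φ
    have e : g.comp A.incl = φ := by ext y; exact hg y
    subst e
    change A.bidualIncl x g = 0
    refine A.apply_eq_zero_of_mem_bidualRange (translateIdeal β A t) ⟨x, rfl⟩ ?_ g
      fun a ha ha' => hφ ⟨a, ha⟩ ha'
    rw [← h, CStarIdeal.mem_bidualRange_iff]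
    intro ψ hψ
    change w ((ψ.comp (starIsoL (β t))).comp A.incl) = 0
    have : (ψ.comp (starIsoL (β t))).comp A.incl = 0 := by
      ext a
      refine hψ _ ?_
      change β t⁻¹ (β t (a : B)) ∈ A.alg
      rw [act_inv_apply]
      exact a.2
    rw [this, map_zero]

/-- The bidual of a C*-enveloping action is a W*-enveloping action. -/
theorem isWStarEnveloping_bidual (hA : IsCStarEnveloping β A) :
    IsWStarEnveloping (bidual A.alg) (restrictAction β A).bidual
      (bidual B) (bidualAction β) A.bidualIncl := by
  have map_act (t : G) (x : (restrictAction β A).bidual.dom t⁻¹) :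
      A.bidualIncl ((restrictAction β A).bidual.act t x) =
        bidualAction β t (A.bidualIncl x) := by
    obtain ⟨x, y, rfl⟩ := x
    have h := (restrictAction β A).bidual_act_bidualIncl t ⟨_, y, rfl⟩ y rfl
    refine (congrArg A.bidualIncl h).trans ?_
    change bidualMap ((A.incl.comp (restrictDom β A t).incl).comp (starIsoL (restrictAct β A t))) y =
      bidualMap ((starIsoL (β t)).comp (A.incl.comp (restrictDom β A t⁻¹).incl)) y
    rfl
  refine
    { isWStarPartialAction := .of_embedding (bidual_isWStarAlgebra A.alg)
        (fun t => (restrictDom β A t).isWStarIdeal_bidualRange) (bidualAction_isWStarAction β)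
        A.bidualIncl_mul A.bidualIncl_star A.isEmbedding_bidualIncl
        (bidualIncl_image_restrictDom β A) map_act
      isWStarAction := bidualAction_isWStarAction β
      ideal := A.isWStarIdeal_bidualRange
      map_mul := A.bidualIncl_mul
      map_star := A.bidualIncl_star
      wstar_embedding := A.isEmbedding_bidualIncl
      map_dom := bidualIncl_image_restrictDom β A
      map_act := map_act
      dense := wstar_closure_eq_univ _ fun φ hφ => ?_ }
  -- Tested on the canonical images of elements of `A`, the hypothesis on `φ` says that it vanishes
  -- on every `β_t(A)`.
  have h1 : (Submodule.span ℂ (⋃ t : G, β t '' (A.alg : Set B)) : Set B) ⊆ {b | φ b = 0} := by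
    change Submodule.span ℂ _ ≤ LinearMap.ker φ.toLinearMap
    rw [Submodule.span_le]
    intro b hb
    obtain ⟨t, a, ha, rfl⟩ := Set.mem_iUnion.1 hb
    refine hφ (bidualAction β t (A.bidualIncl
      (NormedSpace.inclusionInDoubleDual ℂ A.alg ⟨a, ha⟩))) (Submodule.subset_span ?_)
    exact Set.mem_iUnion.2 ⟨t, _, ⟨_, rfl⟩, rfl⟩
  have h2 := closure_minimal h1 (isClosed_eq φ.continuous continuous_const)
  rw [show closure _ = Set.univ from hA] at h2
  ext b
  exact h2 (Set.mem_univ b)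

end BidualEnveloping

/-! ### Automatic weak-* continuity of max-norm projections on dual spaces. -/

section MaxProjection

/-- A linear projection `E` with `‖E x + (1 - E) y‖ ≤ max ‖x‖ ‖y‖`. -/
structure IsMaxProjection {X : Type*} [NormedAddCommGroup X] [NormedSpace ℂ X] (E : X →ₗ[ℂ] X) :
    Prop where
  idem : ∀ x, E (E x) = E x
  norm_le : ∀ x y, ‖E x + (y - E y)‖ ≤ max ‖x‖ ‖y‖

variable {X : Type*} [NormedAddCommGroup X] [NormedSpace ℂ X] {F : Type*} [NormedAddCommGroup F]
  [NormedSpace ℂ F] (e : X ≃ₗᵢ[ℂ] StrongDual ℂ F)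

theorem exists_predual_ultralimit {ι : Type*} (𝒰 : Ultrafilter ι) (x : ι → X) (C : ℝ)
    (h : ∀ᶠ i in 𝒰, ‖x i‖ ≤ C) :
    ∃ y : X, ‖y‖ ≤ C ∧ ∀ φ, Tendsto (fun i => e (x i) φ) 𝒰 (𝓝 (e y φ)) := by
  obtain ⟨y, hy, hlim⟩ := exists_ultralimit 𝒰 (fun i => e (x i)) C (by simpa using h)
  exact ⟨e.symm y, by simpa using hy, by simpa using hlim⟩

theorem ext_predual {x y : X} (h : ∀ φ, e x φ = e y φ) : x = y :=
  e.injective (ContinuousLinearMap.ext h)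

theorem norm_le_of_ultralimit {ι : Type*} {𝒰 : Ultrafilter ι} {x : ι → X} {C : ℝ} {y : X}
    (h : ∀ᶠ i in 𝒰, ‖x i‖ ≤ C) (hlim : ∀ φ, Tendsto (fun i => e (x i) φ) 𝒰 (𝓝 (e y φ))) :
    ‖y‖ ≤ C := by
  obtain ⟨z, hz, hlim'⟩ := exists_predual_ultralimit e 𝒰 x C h
  rwa [ext_predual e fun φ => tendsto_nhds_unique (hlim φ) (hlim' φ)]

/-- A bounded functional on the dual of a Banach space that is small on the part of the unit ball
annihilating a suitable finite set comes from the predual. -/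
theorem exists_predual_of_small [CompleteSpace F] (f : StrongDual ℂ X)
    (hf : ∀ ε > 0, ∃ s : Finset F, ∀ x, ‖x‖ ≤ 1 → (∀ φ ∈ s, e x φ = 0) → ‖f x‖ ≤ ε) :
    ∃ ψ : F, ∀ x, f x = e x ψ := by
  let J : F →ₗᵢ[ℂ] StrongDual ℂ (StrongDual ℂ F) := NormedSpace.inclusionInDoubleDualLi ℂ
  let f' : StrongDual ℂ (StrongDual ℂ F) :=
    f.comp e.symm.toContinuousLinearEquiv.toContinuousLinearMap
  have hf' (y : StrongDual ℂ F) : f' y = f (e.symm y) := rfl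
  suffices h : f' ∈ Set.range J by
    obtain ⟨ψ, hψ⟩ := h
    refine ⟨ψ, fun x => ?_⟩
    have := hf' (e x)
    rw [e.symm_apply_apply] at this
    rw [← this, ← hψ]
    rfl
  rw [← (J.isometry.isClosedEmbedding.isClosed_range).closure_eq, Metric.mem_closure_iff]
  intro ε hε
  obtain ⟨s, hs⟩ := hf (ε / 2) (half_pos hε)
  let L : s → StrongDual ℂ F →ₗ[ℂ] ℂ := fun φ => (J φ).toLinearMap
  let W : Submodule ℂ (StrongDual ℂ F) := ⨅ i, LinearMap.ker (L i)
  have hW (y : StrongDual ℂ F) (hy : y ∈ W) (φ : F) (hφ : φ ∈ s) : y φ = 0 := by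
    have := (Submodule.mem_iInf _).1 hy ⟨φ, hφ⟩
    exact this
  -- `g` extends the restriction of `f'` to the common kernel of `s` without increasing its norm.
  -- Then `f' - g` kills that kernel, so it is a combination of evaluations, and its distance to
  -- `f'` is `‖g‖`.
  obtain ⟨g, hg, hgn⟩ := exists_extension_norm_eq W (f'.comp W.subtypeL)
  have hgε : ‖g‖ ≤ ε / 2 := by
    rw [hgn]
    refine ContinuousLinearMap.opNorm_le_of_unit_norm (by positivity) fun y hy => ?_
    refine hs _ ?_ fun φ hφ => ?_
    · exact (e.symm.norm_map _).trans_le hy.le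
    · refine (DFunLike.congr_fun (e.apply_symm_apply _) φ).trans ?_
      exact hW y y.2 φ hφ
  have hmem : (f' - g).toLinearMap ∈ Submodule.span ℂ (Set.range L) := by
    refine mem_span_of_iInf_ker_le_ker fun y hy => ?_
    have := hg ⟨y, hy⟩
    rw [LinearMap.mem_ker]
    exact sub_eq_zero.2 this.symm
  have hmem' : ∃ ψ, (J ψ).toLinearMap = (f' - g).toLinearMap := by
    have hle : Submodule.span ℂ (Set.range L) ≤
        LinearMap.range (ContinuousLinearMap.coeLM ℂ ∘ₗ J.toLinearMap) := by
      rw [Submodule.span_le]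
      rintro _ ⟨φ, rfl⟩
      exact ⟨φ, rfl⟩
    exact hle hmem
  obtain ⟨ψ, hψ⟩ := hmem'
  have hψ' : J ψ = f' - g := ContinuousLinearMap.coe_injective hψ
  refine ⟨_, ⟨ψ, rfl⟩, ?_⟩
  rw [dist_eq_norm, hψ', show f' - (f' - g) = g by abel]
  linarith

namespace IsMaxProjection

variable {e} {E : X →ₗ[ℂ] X}

theorem norm_apply_le (hE : IsMaxProjection E) (x : X) : ‖E x‖ ≤ ‖x‖ := by
  simpa using hE.norm_le x 0

theorem norm_sub_apply_le (hE : IsMaxProjection E) (x : X) : ‖x - E x‖ ≤ ‖x‖ := by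
  simpa using hE.norm_le 0 x

theorem compl (hE : IsMaxProjection E) : IsMaxProjection (LinearMap.id - E) where
  idem x := by simp [hE.idem]
  norm_le x y := by
    have := hE.norm_le y x
    rw [max_comm]
    convert this using 2
    simp
    abel

/-- Put `d = y - E y`. The max-norm inequality gives `‖x_i + n d‖ ≤ n ‖d‖` once `n ‖d‖ ≥ C`, and the
bound passes to the limit `y + n d`. But `1 - E` is a contraction sending this limit to `(n + 1) d`,
which forces `d = 0`. -/
theorem apply_eq_of_ultralimit (hE : IsMaxProjection E) {ι : Type*} {𝒰 : Ultrafilter ι} {x : ι → X} {C : ℝ} {y : X}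
    (h : ∀ i, ‖x i‖ ≤ C) (hx : ∀ i, E (x i) = x i)
    (hlim : ∀ φ, Tendsto (fun i => e (x i) φ) 𝒰 (𝓝 (e y φ))) : E y = y := by
  by_contra hne
  set d := y - E y with hd
  have hd0 : 0 < ‖d‖ := norm_pos_iff.2 (sub_ne_zero.2 (Ne.symm hne))
  have hEd : E d = 0 := by simp [hd, hE.idem]
  obtain ⟨n, hn⟩ := exists_nat_ge (C / ‖d‖)
  have hn' : C ≤ n * ‖d‖ := (div_le_iff₀ hd0).1 hn
  have hnd : ‖(n : ℂ) • d‖ = n * ‖d‖ := by rw [norm_smul]; simp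
  have h1 : ‖y + (n : ℂ) • d‖ ≤ n * ‖d‖ := by
    refine norm_le_of_ultralimit e (𝒰 := 𝒰) (x := fun i => x i + (n : ℂ) • d) (.of_forall fun i => ?_)
      fun φ => ?_
    · have := hE.norm_le (x i) ((n : ℂ) • d)
      rw [hx, map_smul, hEd, smul_zero, sub_zero, hnd] at this
      exact this.trans (max_le ((h i).trans hn') le_rfl)
    · simpa using (hlim φ).add_const _
  have h2 := hE.norm_sub_apply_le (y + (n : ℂ) • d)
  have h3 : y + (n : ℂ) • d - E (y + (n : ℂ) • d) = ((n + 1 : ℕ) : ℂ) • d := by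
    rw [map_add, map_smul, hEd, smul_zero, add_zero, add_sub_right_comm, ← hd]
    push_cast
    module
  rw [h3, norm_smul, Complex.norm_natCast] at h2
  push_cast at h2
  linarith

/-- The ranges of `E` and `1 - E` are both closed under bounded ultralimits, so the limits of the
two components of `x_i` are the two components of `y`. -/
theorem tendsto_of_ultralimit (hE : IsMaxProjection E) {ι : Type*} {𝒰 : Ultrafilter ι} {x : ι → X} {C : ℝ} {y : X}
    (h : ∀ i, ‖x i‖ ≤ C) (hlim : ∀ φ, Tendsto (fun i => e (x i) φ) 𝒰 (𝓝 (e y φ))) (φ : F) :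
    Tendsto (fun i => e (E (x i)) φ) 𝒰 (𝓝 (e (E y) φ)) := by
  obtain ⟨a, -, ha⟩ := exists_predual_ultralimit e 𝒰 (fun i => E (x i)) C
    (.of_forall fun i => (hE.norm_apply_le _).trans (h i))
  obtain ⟨b, -, hb⟩ := exists_predual_ultralimit e 𝒰 (fun i => x i - E (x i)) C
    (.of_forall fun i => (hE.norm_sub_apply_le _).trans (h i))
  have h1 : E a = a := hE.apply_eq_of_ultralimit
    (fun i => (hE.norm_apply_le _).trans (h i)) (fun i => hE.idem _) ha
  have h2 : (LinearMap.id - E : X →ₗ[ℂ] X) b = b := hE.compl.apply_eq_of_ultralimit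
    (fun i => (hE.norm_sub_apply_le _).trans (h i)) (fun i => by simp [hE.idem]) hb
  have h3 : E b = 0 := by simpa using h2
  have h4 : y = a + b := by
    refine ext_predual e fun φ => tendsto_nhds_unique (hlim φ) ?_
    simpa using (ha φ).add (hb φ)
  rw [h4, map_add, h1, h3, add_zero]
  exact ha φ

/-- On the dual of a Banach space such projections are weak-* continuous. -/
theorem exists_predual (hE : IsMaxProjection E) [CompleteSpace F] (φ : F) : ∃ ψ : F, ∀ x, e (E x) φ = e x ψ := by
  let f : StrongDual ℂ X := LinearMap.mkContinuous
    { toFun := fun x => e (E x) φ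
      map_add' := fun x y => by simp
      map_smul' := fun c x => by simp } ‖φ‖ fun x => by
        refine ((e (E x)).le_opNorm φ).trans ?_
        rw [mul_comm, e.norm_map]
        gcongr
        exact hE.norm_apply_le x
  refine exists_predual_of_small e f fun ε hε => ?_
  -- Failure yields a net in the unit ball, indexed by finite subsets of `F`, that tends weak-* to
  -- zero while `|e (E x_s) φ|` stays above `ε`. This contradicts continuity along bounded
  -- ultralimits.
  by_contra! hcon
  choose x hx1 hx2 hx3 using hcon
  let 𝒰 : Ultrafilter (Finset F) := Ultrafilter.of atTop
  have h0 (ψ : F) : Tendsto (fun s => e (x s) ψ) 𝒰 (𝓝 (e (0 : X) ψ)) := by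
    refine tendsto_const_nhds.congr' ?_
    have : ∀ᶠ s in (atTop : Filter (Finset F)), e (0 : X) ψ = e (x s) ψ := by
      filter_upwards [eventually_ge_atTop {ψ}] with s hs
      rw [hx2 s ψ (hs (Finset.mem_singleton_self ψ))]
      simp
    exact Ultrafilter.of_le _ this
  have h1 := hE.tendsto_of_ultralimit hx1 h0 φ
  have h2 : Tendsto (fun s => ‖e (E (x s)) φ‖) 𝒰 (𝓝 0) := by
    simpa only [map_zero, zero_apply, norm_zero] using h1.norm
  have h3 := ge_of_tendsto' h2 fun s => (hx3 s).le
  linarith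

theorem tendsto_predual (hE : IsMaxProjection E) [CompleteSpace F] {ι : Type*} {l : Filter ι} {x : ι → X} {y : X}
    (hlim : ∀ φ, Tendsto (fun i => e (x i) φ) l (𝓝 (e y φ))) (φ : F) :
    Tendsto (fun i => e (E (x i)) φ) l (𝓝 (e (E y) φ)) := by
  obtain ⟨ψ, hψ⟩ := hE.exists_predual (e := e) φ
  simpa only [hψ] using hlim ψ

end IsMaxProjection

end MaxProjection

/-! ### Central projections: suprema, gluing and separation. -/

section CentralProjection

variable {N : Type*} [CStarAlgebra N]

/-- Central projections of a C*-algebra. -/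
structure IsCentralProjection (p : N) : Prop where
  star_eq : star p = p
  mul_self : p * p = p
  comm : ∀ x, p * x = x * p

namespace IsCentralProjection

variable {p q : N}

theorem isMaxProjection (hp : IsCentralProjection p) : IsMaxProjection (LinearMap.mulLeft ℂ p) where
  idem x := by simp [← mul_assoc, hp.mul_self]
  norm_le x y := by
    have h1 (x : N) : p * (p * x) = p * x := by rw [← mul_assoc, hp.mul_self]
    have h2 (x y : N) : x * (p * y) = p * (x * y) := by
      rw [← mul_assoc, ← hp.comm, mul_assoc]
    -- Centrality makes `(x, y) ↦ p x + (1 - p) y` a *-homomorphism, hence contractive for the max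
    -- norm of the product.
    let π : N × N →⋆ₙₐ[ℂ] N :=
      { toFun := fun z => p * z.1 + (z.2 - p * z.2)
        map_smul' := fun c z => by simp [smul_sub]
        map_zero' := by simp
        map_add' := fun z w => by simp only [Prod.fst_add, Prod.snd_add, mul_add]; abel
        map_mul' := fun z w => by
          simp only [Prod.fst_mul, Prod.snd_mul, mul_add, add_mul, mul_sub, sub_mul, h1, h2,
            mul_assoc]
          abel
        map_star' := fun z => by
          simp [hp.star_eq, hp.comm] }
    exact NonUnitalStarAlgHom.norm_apply_le π (x, y)

theorem sup (hp : IsCentralProjection p) (hq : IsCentralProjection q) :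
    IsCentralProjection (p + q - p * q) where
  star_eq := by simp [hp.star_eq, hq.star_eq, hp.comm]
  mul_self := by
    have h1 : q * (p * q) = p * q := by rw [← mul_assoc, ← hp.comm, mul_assoc, hq.mul_self]
    have h2 : q * p = p * q := hq.comm p
    have h3 : p * (p * q) = p * q := by rw [← mul_assoc, hp.mul_self]
    have h4 : p * q * p = p * q := by rw [mul_assoc, h2, h3]
    have h5 : p * q * q = p * q := by rw [mul_assoc, hq.mul_self]
    have h6 : p * q * (p * q) = p * q := by rw [← mul_assoc, h4, h5]
    simp only [add_mul, sub_mul, mul_add, mul_sub, hp.mul_self, hq.mul_self, h1, h2, h3, h4, h5, h6]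
    abel
  comm x := by
    rw [sub_mul, add_mul, mul_sub, mul_add, hp.comm x, hq.comm x, mul_assoc, hq.comm x, ← mul_assoc,
      hp.comm x, mul_assoc]

theorem zero : IsCentralProjection (0 : N) := ⟨by simp, by simp, by simp⟩

end IsCentralProjection

/-- Finitely many central projections have a supremum. -/
theorem exists_finset_sup_centralProjection {G : Type*} (p : G → N)
    (hp : ∀ t, IsCentralProjection (p t)) (S : Finset G) :
    ∃ q, IsCentralProjection q ∧ (∀ t ∈ S, p t * q = p t) ∧
      ∀ z, (∀ t ∈ S, p t * z = 0) → q * z = 0 := by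
  classical
  induction S using Finset.induction_on with
  | empty => exact ⟨0, .zero, by simp, by simp⟩
  | insert s S hs ih =>
    obtain ⟨q, hq, h1, h2⟩ := ih
    refine ⟨p s + q - p s * q, (hp s).sup hq, ?_, fun z hz => ?_⟩
    · intro t ht
      rw [mul_sub, mul_add, ← mul_assoc]
      rcases Finset.mem_insert.1 ht with rfl | ht
      · rw [(hp t).mul_self]; abel
      · rw [h1 t ht, (hp t).comm (p s), mul_assoc, h1 t ht]; abel
    · have h3 := h2 z fun t ht => hz t (Finset.mem_insert_of_mem ht)
      have h4 := hz s (Finset.mem_insert_self s S)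
      rw [sub_mul, add_mul, h3, h4, mul_assoc, h3]
      simp

/-- Elements prescribed compatibly under finitely many central projections can be glued. -/
theorem exists_finset_glue {G : Type*} (p : G → N) (hp : ∀ t, IsCentralProjection (p t))
    (g : G → N) (hg : ∀ t, p t * g t = g t) (hc : ∀ s t, p s * g t = p t * g s) (C : ℝ)
    (hC0 : 0 ≤ C) (hC : ∀ t, ‖g t‖ ≤ C) (S : Finset G) :
    ∃ x, ‖x‖ ≤ C ∧ ∀ t ∈ S, p t * x = g t := by
  classical
  induction S using Finset.induction_on with
  | empty => exact ⟨0, by simpa using hC0, by simp⟩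
  | insert s S hs ih =>
    obtain ⟨x, hx, h1⟩ := ih
    refine ⟨g s + (x - p s * x), ?_, fun t ht => ?_⟩
    · have := (hp s).isMaxProjection.norm_le (g s) x
      simp only [LinearMap.mulLeft_apply, hg] at this
      exact this.trans (max_le (hC s) hx)
    · rw [mul_add, mul_sub]
      rcases Finset.mem_insert.1 ht with rfl | ht
      · rw [hg, ← mul_assoc, (hp t).mul_self]; abel
      · rw [← mul_assoc, (hp t).comm (p s), mul_assoc, h1 t ht, hc]; abel

variable {F : Type*} [NormedAddCommGroup F] [NormedSpace ℂ F] [CompleteSpace F]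

theorem exists_glue (e : N ≃ₗᵢ[ℂ] StrongDual ℂ F) {G : Type*} (p : G → N) (hp : ∀ t, IsCentralProjection (p t))
    (g : G → N) (hg : ∀ t, p t * g t = g t) (hc : ∀ s t, p s * g t = p t * g s) (C : ℝ)
    (hC0 : 0 ≤ C) (hC : ∀ t, ‖g t‖ ≤ C) :
    ∃ x, ‖x‖ ≤ C ∧ ∀ t, p t * x = g t := by
  choose x hx h1 using exists_finset_glue p hp g hg hc C hC0 hC
  -- The finite gluings share the bound `C`, so they have an ultralimit. Weak-* continuity of
  -- multiplication by `p t` transfers the eventually constant values to it.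
  let 𝒰 : Ultrafilter (Finset G) := Ultrafilter.of atTop
  obtain ⟨y, hy, hlim⟩ := exists_predual_ultralimit e 𝒰 x C (.of_forall hx)
  refine ⟨y, hy, fun t => ext_predual e fun φ => ?_⟩
  have h2 := (hp t).isMaxProjection.tendsto_predual hlim φ
  refine tendsto_nhds_unique h2 (tendsto_const_nhds.congr' ?_)
  refine Ultrafilter.of_le _ ?_
  filter_upwards [eventually_ge_atTop {t}] with S hS
  rw [LinearMap.mulLeft_apply, h1 S t (hS (Finset.mem_singleton_self t))]

/-- If the ideals `p_t N` generate `N` as a weak-* closed subspace, an element annihilated by all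
the central projections `p_t` vanishes. -/
theorem eq_zero_of_forall_mul_eq_zero (e : N ≃ₗᵢ[ℂ] StrongDual ℂ F) {G : Type*}
    (p : G → N) (hp : ∀ t, IsCentralProjection (p t))
    (hsep : ∀ ψ : F, (∀ t m, p t * m = m → e m ψ = 0) → ψ = 0) (x : N) (hx : ∀ t, p t * x = 0) :
    x = 0 := by
  choose q hq h1 h2 using exists_finset_sup_centralProjection p hp
  let 𝒰 : Ultrafilter (Finset G) := Ultrafilter.of atTop
  have hex (x : N) := exists_predual_ultralimit e 𝒰 (fun S => q S * x) ‖x‖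
    (.of_forall fun S => (hq S).isMaxProjection.norm_apply_le x)
  choose L hL hlim using hex
  have hLt (t : G) (x : N) : p t * L x = p t * x := by
    refine ext_predual e fun φ => ?_
    have h3 := (hp t).isMaxProjection.tendsto_predual (hlim x) φ
    refine tendsto_nhds_unique h3 (tendsto_const_nhds.congr' ?_)
    refine Ultrafilter.of_le _ ?_
    filter_upwards [eventually_ge_atTop {t}] with S hS
    rw [LinearMap.mulLeft_apply, ← mul_assoc, h1 S t (hS (Finset.mem_singleton_self t))]
  have hLq (S : Finset G) (x : N) : q S * L x = q S * x := by
    rw [← sub_eq_zero, ← mul_sub]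
    refine h2 S _ fun t _ => ?_
    rw [mul_sub, hLt, sub_self]
  -- `E` plays the role of multiplication by the supremum of all `p_t`: it is the limit of
  -- multiplication by the finite suprema `q S`.
  let E : N →ₗ[ℂ] N :=
    { toFun := L
      map_add' := fun x y => by
        refine ext_predual e fun φ => tendsto_nhds_unique (hlim _ φ) ?_
        simpa [mul_add] using (hlim x φ).add (hlim y φ)
      map_smul' := fun c x => by
        refine ext_predual e fun φ => tendsto_nhds_unique (hlim _ φ) ?_
        simpa using (hlim x φ).const_mul c }
  have hEL (x : N) : E x = L x := rfl
  have hE : IsMaxProjection E := by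
    refine ⟨fun x => ?_, fun x y => ?_⟩
    · refine ext_predual e fun φ => tendsto_nhds_unique (hlim _ φ) ?_
      simpa only [hEL, hLq] using hlim x φ
    · refine norm_le_of_ultralimit e (𝒰 := 𝒰) (x := fun S => q S * x + (y - q S * y))
        (.of_forall fun S => (hq S).isMaxProjection.norm_le x y) fun φ => ?_
      simpa [hEL] using (hlim x φ).add ((hlim y φ).const_sub (e y φ))
  -- `E` fixes every `p_t N`. By weak-* continuity, `φ ∘ E` comes from a predual element `ψ`, and `ψ
  -- - φ` vanishes on all `p_t N`, so the separation hypothesis gives `ψ = φ`.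
  have hid (y : N) : E y = y := by
    refine ext_predual e fun φ => ?_
    obtain ⟨ψ, hψ⟩ := hE.exists_predual (e := e) φ
    have : ψ - φ = 0 := by
      refine hsep _ fun t m hm => ?_
      rw [map_sub, ← hψ, sub_eq_zero]
      congr 2
      refine ext_predual e fun φ => tendsto_nhds_unique (hlim _ φ) (tendsto_const_nhds.congr' ?_)
      refine Ultrafilter.of_le _ ?_
      filter_upwards [eventually_ge_atTop {t}] with S hS
      have h3 := h1 S t (hS (Finset.mem_singleton_self t))
      rw [← hm, ← mul_assoc, (hq S).comm, h3]
    rw [hψ, sub_eq_zero.1 this]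
  rw [← hid x, hEL]
  refine ext_predual e fun φ => tendsto_nhds_unique (hlim _ φ) ?_
  have h3 (S : Finset G) : q S * x = 0 := h2 S x fun t _ => hx t
  simp only [h3]
  exact tendsto_const_nhds

end CentralProjection

/-! ### Uniqueness of enveloping actions in C*-algebraic terms. -/

section Uniqueness

variable {G : Type*} [Group G] {M : Type*} [CStarAlgebra M]
  {N : Type*} [CStarAlgebra N] {F : Type*} [NormedAddCommGroup F] [NormedSpace ℂ F]
  {N' : Type*} [CStarAlgebra N'] {F' : Type*} [NormedAddCommGroup F'] [NormedSpace ℂ F']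

/-- `M` is embedded as an ideal of `N`, and its translates under the action `σ` separate the points
of the predual of `N`. -/
structure IsEnvelopingIdeal (e : N ≃ₗᵢ[ℂ] StrongDual ℂ F) (σ : G → N →⋆ₙₐ[ℂ] N)
    (ι : M →⋆ₙₐ[ℂ] N) : Prop where
  injective : Function.Injective ι
  mul_left : ∀ a x, ∃ y, ι y = a * ι x
  mul_right : ∀ a x, ∃ y, ι y = ι x * a
  act_one : ∀ x, σ 1 x = x
  act_mul : ∀ s t x, σ (s * t) x = σ s (σ t x)
  separating : ∀ ψ : F, (∀ t m, e (σ t (ι m)) ψ = 0) → ψ = 0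

/-- `x` and `x'` restrict to the same elements of `M` under all translations. -/
def SameRestrictions (σ : G → N →⋆ₙₐ[ℂ] N) (ι : M →⋆ₙₐ[ℂ] N) (σ' : G → N' →⋆ₙₐ[ℂ] N')
    (ι' : M →⋆ₙₐ[ℂ] N') (x : N) (x' : N') : Prop :=
  ∀ t, ∃ m, ι m = ι 1 * σ t x ∧ ι' m = ι' 1 * σ' t x'

namespace IsEnvelopingIdeal

variable {e : N ≃ₗᵢ[ℂ] StrongDual ℂ F} {σ : G → N →⋆ₙₐ[ℂ] N} {ι : M →⋆ₙₐ[ℂ] N}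
  {e' : N' ≃ₗᵢ[ℂ] StrongDual ℂ F'} {σ' : G → N' →⋆ₙₐ[ℂ] N'} {ι' : M →⋆ₙₐ[ℂ] N'}

theorem act_act_inv (h : IsEnvelopingIdeal e σ ι) (t : G) (x : N) : σ t (σ t⁻¹ x) = x := by
  rw [← h.act_mul, mul_inv_cancel, h.act_one]

theorem isCentralProjection_one (h : IsEnvelopingIdeal e σ ι) : IsCentralProjection (ι 1) where
  star_eq := by rw [← map_star, star_one]
  mul_self := by rw [← map_mul, one_mul]
  comm x := by
    obtain ⟨y, hy⟩ := h.mul_left x 1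
    obtain ⟨z, hz⟩ := h.mul_right x 1
    have h1 : ι 1 * (ι 1 * x) = ι 1 * x := by rw [← mul_assoc, ← map_mul, one_mul]
    have h2 : x * ι 1 * ι 1 = x * ι 1 := by rw [mul_assoc, ← map_mul, one_mul]
    have h3 : ι 1 * x * ι 1 = ι 1 * x := by rw [← hz, ← map_mul, mul_one]
    have h4 : ι 1 * (x * ι 1) = x * ι 1 := by rw [← hy, ← map_mul, one_mul]
    rw [← h3, mul_assoc, h4]

theorem isCentralProjection (h : IsEnvelopingIdeal e σ ι) (t : G) :
    IsCentralProjection (σ t (ι 1)) where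
  star_eq := by rw [← map_star, h.isCentralProjection_one.star_eq]
  mul_self := by rw [← map_mul, h.isCentralProjection_one.mul_self]
  comm x := by
    rw [← h.act_act_inv t x, ← map_mul, h.isCentralProjection_one.comm, map_mul]

theorem ext [CompleteSpace F] (h : IsEnvelopingIdeal e σ ι) {x y : N}
    (hxy : ∀ t, ι 1 * σ t x = ι 1 * σ t y) : x = y := by
  rw [← sub_eq_zero]
  refine eq_zero_of_forall_mul_eq_zero e (fun t => σ t (ι 1)) h.isCentralProjection
    (fun ψ hψ => h.separating ψ fun t m => hψ t _ ?_) _ fun t => ?_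
  · rw [← map_mul, ← map_mul, one_mul]
  · rw [← h.act_act_inv t (x - y), ← map_mul, map_sub, mul_sub, hxy, sub_self, map_zero]

/-- The piece of `x` in the ideal `σ_t(ι(M))` is `σ_t(ι(f_t))` with `f_t ∈ M`. The elements
`σ'_t(ι'(f_t))` are compatible because, by `H`, both actions induce the same partial action on `M`;
they are glued in `N'`. -/
theorem exists_sameRestrictions [CompleteSpace F'] (h : IsEnvelopingIdeal e σ ι)
    (h' : IsEnvelopingIdeal e' σ' ι')
    (H : ∀ r y y', σ r (ι y) = ι y' ↔ σ' r (ι' y) = ι' y') (x : N) :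
    ∃ x', ‖x'‖ ≤ ‖x‖ ∧ SameRestrictions σ ι σ' ι' x x' := by
  have hex (t : G) : ∃ m, ι m = ι 1 * σ t⁻¹ x := h.mul_right _ _
  choose f hf using hex
  have hone (m : M) : ι 1 * ι m = ι m := by rw [← map_mul, one_mul]
  have hone' (m : M) : ι' 1 * ι' m = ι' m := by rw [← map_mul, one_mul]
  have key (s t : G) : ι' 1 * σ' (s⁻¹ * t) (ι' (f t)) = σ' (s⁻¹ * t) (ι' 1) * ι' (f s) := by
    set r := s⁻¹ * t with hr
    -- `u` and `u'` are the elements of `M` whose images under `ι'` are the units of `ι'(M) ∩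
    -- σ'_{r⁻¹}(ι'(M))` and `ι'(M) ∩ σ'_r(ι'(M))`. Cutting by them moves the relation into the
    -- domain of the partial action, where `H` carries it from one algebra to the other.
    obtain ⟨u, hu⟩ := h'.mul_right (σ' r⁻¹ (ι' 1)) 1
    obtain ⟨u', hu'⟩ := h'.mul_right (σ' r (ι' 1)) 1
    have h1 : σ r (ι u) = ι u' := by
      rw [H, hu, hu', map_mul, h'.act_act_inv, h'.isCentralProjection_one.comm]
    have h2 : σ r (ι (u * f t)) = ι (u' * f s) := by
      have hx : σ r (σ t⁻¹ x) = σ s⁻¹ x := by rw [← h.act_mul, hr, mul_assoc, mul_inv_cancel, mul_one]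
      rw [map_mul, hf, ← mul_assoc, ← map_mul ι, mul_one, map_mul (σ r), h1, hx, map_mul, hf,
        ← mul_assoc, ← map_mul ι, mul_one]
    have h3 := (H r _ _).1 h2
    rw [map_mul ι', map_mul (σ' r), hu, map_mul (σ' r), h'.act_act_inv, map_mul ι', hu'] at h3
    have hp := h'.isCentralProjection_one.comm (σ' r (ι' 1))
    calc ι' 1 * σ' r (ι' (f t)) = ι' 1 * (σ' r (ι' 1) * σ' r (ι' (f t))) := by
          rw [← map_mul (σ' r), hone']
      _ = ι' 1 * σ' r (ι' 1) * ι' (f s) := by rw [← mul_assoc, hp, h3, hp]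
      _ = σ' r (ι' 1) * ι' (f s) := by rw [hp, mul_assoc, hone']
  have hc (s t : G) : σ' s (ι' 1) * σ' t (ι' (f t)) = σ' t (ι' 1) * σ' s (ι' (f s)) := by
    have := congrArg (σ' s) (key s t)
    rwa [map_mul, map_mul, ← h'.act_mul, ← h'.act_mul, mul_inv_cancel_left] at this
  have hn (t : G) : ‖σ' t (ι' (f t))‖ ≤ ‖x‖ :=
    calc ‖σ' t (ι' (f t))‖ ≤ ‖ι' (f t)‖ := NonUnitalStarAlgHom.norm_apply_le _ _
      _ ≤ ‖f t‖ := NonUnitalStarAlgHom.norm_apply_le _ _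
      _ = ‖ι (f t)‖ := (NonUnitalStarAlgHom.norm_map ι h.injective _).symm
      _ = ‖ι 1 * σ t⁻¹ x‖ := by rw [hf]
      _ ≤ ‖σ t⁻¹ x‖ := h.isCentralProjection_one.isMaxProjection.norm_apply_le _
      _ ≤ ‖x‖ := NonUnitalStarAlgHom.norm_apply_le _ _
  obtain ⟨x', hx', hglue⟩ := exists_glue e' (fun t => σ' t (ι' 1)) h'.isCentralProjection
    (fun t => σ' t (ι' (f t))) (fun t => by rw [← map_mul, hone']) hc ‖x‖ (norm_nonneg _) hn
  refine ⟨x', hx', fun t => ⟨f t⁻¹, by rw [hf, inv_inv], ?_⟩⟩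
  have := congrArg (σ' t) (hglue t⁻¹)
  rw [map_mul, h'.act_act_inv, h'.act_act_inv] at this
  exact this.symm

theorem sameRestrictions_unique [CompleteSpace F'] (h : IsEnvelopingIdeal e σ ι)
    (h' : IsEnvelopingIdeal e' σ' ι') {x : N} {x' x'' : N'}
    (h1 : SameRestrictions σ ι σ' ι' x x') (h2 : SameRestrictions σ ι σ' ι' x x'') : x' = x'' := by
  refine h'.ext fun t => ?_
  obtain ⟨m, hm, hm'⟩ := h1 t
  obtain ⟨n, hn, hn'⟩ := h2 t
  rw [← hm', ← hn', h.injective (hm.trans hn.symm)]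

/-- The W*-enveloping action is unique up to isomorphism. -/
theorem exists_equiv [CompleteSpace F] [CompleteSpace F'] (h : IsEnvelopingIdeal e σ ι)
    (h' : IsEnvelopingIdeal e' σ' ι')
    (H : ∀ r y y', σ r (ι y) = ι y' ↔ σ' r (ι' y) = ι' y') :
    ∃ θ : N ≃ₗᵢ[ℂ] N', (∀ x y, θ (x * y) = θ x * θ y) ∧ (∀ x, θ (star x) = star (θ x)) ∧
      ∀ t x, θ (σ t x) = σ' t (θ x) := by
  -- The relation `SameRestrictions` is a single-valued correspondence defined everywhere in both
  -- directions and compatible with all operations. Uniqueness thus yields every law of `θ`, and the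
  -- two norm bounds make it isometric.
  choose θ hθ hR using h.exists_sameRestrictions h' H
  choose θ' hθ' hR' using h'.exists_sameRestrictions h fun r y y' => (H r y y').symm
  have symm {x : N} {x' : N'} (hx : SameRestrictions σ ι σ' ι' x x') :
      SameRestrictions σ' ι' σ ι x' x := fun t => (hx t).imp fun m hm => hm.symm
  have uniq {x : N} {x' : N'} (hx : SameRestrictions σ ι σ' ι' x x') : θ x = x' :=
    h.sameRestrictions_unique h' (hR x) hx
  have hinv (x : N) : θ' (θ x) = x := h'.sameRestrictions_unique h (hR' _) (symm (hR x))
  have hinv' (x : N') : θ (θ' x) = x := uniq fun t => (hR' x t).imp fun m hm => hm.symm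
  refine ⟨{ toFun := θ, invFun := θ', left_inv := hinv, right_inv := hinv',
            map_add' := fun x y => uniq fun t => ?_, map_smul' := fun c x => uniq fun t => ?_,
            norm_map' := fun x => le_antisymm (hθ x) ?_ }, fun x y => uniq fun t => ?_,
    fun x => uniq fun t => ?_, fun s x => uniq fun t => ?_⟩
  · obtain ⟨m, hm, hm'⟩ := hR x t
    obtain ⟨n, hn, hn'⟩ := hR y t
    exact ⟨m + n, by simp [hm, hn, mul_add], by simp [hm', hn', mul_add]⟩
  · obtain ⟨m, hm, hm'⟩ := hR x t
    exact ⟨c • m, by simp [hm], by simp [hm']⟩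
  · have := hθ' (θ x)
    rwa [hinv] at this
  · obtain ⟨m, hm, hm'⟩ := hR x t
    obtain ⟨n, hn, hn'⟩ := hR y t
    refine ⟨m * n, ?_, ?_⟩
    · have hp := h.isCentralProjection_one
      rw [map_mul, hm, hn, map_mul, mul_assoc, ← mul_assoc (σ t x), ← hp.comm, mul_assoc, ← mul_assoc,
        hp.mul_self]
    · have hp := h'.isCentralProjection_one
      change _ = _ * σ' t (θ x * θ y)
      rw [map_mul, hm', hn', map_mul, mul_assoc, ← mul_assoc (σ' t (θ x)), ← hp.comm, mul_assoc,
        ← mul_assoc, hp.mul_self]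
  · obtain ⟨m, hm, hm'⟩ := hR x t
    refine ⟨star m, ?_, ?_⟩
    · have hp := h.isCentralProjection_one
      rw [map_star, hm, star_mul, hp.star_eq, map_star, hp.comm]
    · have hp := h'.isCentralProjection_one
      change _ = _ * σ' t (star (θ x))
      rw [map_star, hm', star_mul, hp.star_eq, map_star, hp.comm]
  · obtain ⟨m, hm, hm'⟩ := hR x (t * s)
    exact ⟨m, by rw [hm, h.act_mul], by rw [hm', h'.act_mul]; rfl⟩

end IsEnvelopingIdeal

end Uniqueness

/-! ### W*-algebras as bundled C*-algebras. -/

section WStarType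

variable {E : Type u} [NormedAddCommGroup E] [NormedSpace ℂ E] {M : DualStarAlgebra E}

theorem DualStarAlgebra.IsWStarAlgebra.zero_mul_eq (h : M.IsWStarAlgebra) (x : StrongDual ℂ E) :
    M.mul 0 x = 0 := by
  have := h.add_mul 0 0 x
  rwa [add_zero, left_eq_add] at this

theorem DualStarAlgebra.IsWStarAlgebra.mul_zero_eq (h : M.IsWStarAlgebra) (x : StrongDual ℂ E) :
    M.mul x 0 = 0 := by
  have := h.mul_add x 0 0
  rwa [add_zero, left_eq_add] at this

/-- The C*-algebra underlying a W*-algebra. -/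
def WStarType (_ : M.IsWStarAlgebra) : Type u := StrongDual ℂ E

variable (h : M.IsWStarAlgebra)

instance : NormedAddCommGroup (WStarType h) := inferInstanceAs (NormedAddCommGroup (StrongDual ℂ E))

instance : NormedSpace ℂ (WStarType h) := inferInstanceAs (NormedSpace ℂ (StrongDual ℂ E))

instance : CompleteSpace (WStarType h) := inferInstanceAs (CompleteSpace (StrongDual ℂ E))

instance : NormedRing (WStarType h) where
  mul := M.mul
  one := h.exists_one.choose
  left_distrib := h.mul_add
  right_distrib := h.add_mul
  mul_assoc := h.mul_assoc
  one_mul x := (h.exists_one.choose_spec x).1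
  mul_one x := (h.exists_one.choose_spec x).2
  zero_mul := h.zero_mul_eq
  mul_zero := h.mul_zero_eq
  dist_eq x y := by rw [dist_eq_norm, ← norm_neg, neg_sub, sub_eq_add_neg, add_comm]
  norm_mul_le := h.norm_mul_le
  neg_add_cancel := neg_add_cancel
  zsmul n x := n • x
  zsmul_zero' := SubNegMonoid.zsmul_zero'
  zsmul_succ' := SubNegMonoid.zsmul_succ'
  zsmul_neg' := SubNegMonoid.zsmul_neg'

instance : NormedAlgebra ℂ (WStarType h) where
  __ := Algebra.ofModule (A := WStarType h) h.smul_mul h.mul_smul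
  norm_smul_le := norm_smul_le

instance : StarRing (WStarType h) where
  star := M.star
  star_involutive := h.star_star
  star_mul := h.star_mul
  star_add := h.star_add

instance : CStarAlgebra (WStarType h) where
  norm_mul_self_le x := (h.norm_star_mul_self x).ge
  star_smul := h.star_smul

end WStarType

/-! ### Uniqueness of the W*-enveloping action. -/

section Uniqueness

variable {G : Type v} [Group G] {E : Type*} [NormedAddCommGroup E] [NormedSpace ℂ E]
  {F : Type*} [NormedAddCommGroup F] [NormedSpace ℂ F]
  {F' : Type*} [NormedAddCommGroup F'] [NormedSpace ℂ F']
  {M : DualStarAlgebra E} {N : DualStarAlgebra F} {N' : DualStarAlgebra F'}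

/-- A multiplicative *-preserving map of W*-algebras as a *-homomorphism. -/
def WStarType.starHom (hM : M.IsWStarAlgebra) (hN : N.IsWStarAlgebra)
    (f : StrongDual ℂ E →ₗ[ℂ] StrongDual ℂ F) (hmul : ∀ x y, f (M.mul x y) = N.mul (f x) (f y))
    (hstar : ∀ x, f (M.star x) = N.star (f x)) : WStarType hM →⋆ₙₐ[ℂ] WStarType hN where
  toFun := f
  map_smul' := f.map_smul
  map_zero' := f.map_zero
  map_add' := f.map_add
  map_mul' := hmul
  map_star' := hstar

/-- The identification of a W*-algebra with the dual of its predual. -/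
def WStarType.dualEquiv (hN : N.IsWStarAlgebra) : WStarType hN ≃ₗᵢ[ℂ] StrongDual ℂ F :=
  LinearIsometryEquiv.refl ℂ (StrongDual ℂ F)

variable {γ : PartialFamily G (StrongDual ℂ E)} {σ : G → StrongDual ℂ F →ₗ[ℂ] StrongDual ℂ F}
  {ι : StrongDual ℂ E →ₗ[ℂ] StrongDual ℂ F} {σ' : G → StrongDual ℂ F' →ₗ[ℂ] StrongDual ℂ F'}
  {ι' : StrongDual ℂ E →ₗ[ℂ] StrongDual ℂ F'}

namespace IsWStarEnveloping

theorem injective (h : IsWStarEnveloping M γ N σ ι) : Function.Injective ι := by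
  let := wstar E
  let := wstar F
  exact h.wstar_embedding.injective

/-- The right-hand side does not mention the enveloping action; comparing two enveloping actions
through it supplies the hypothesis `H` of `IsEnvelopingIdeal.exists_equiv`. -/
theorem act_eq_iff (h : IsWStarEnveloping M γ N σ ι) (t : G) (x y : StrongDual ℂ E) :
    σ t (ι x) = ι y ↔ ∃ hx : x ∈ γ.dom t⁻¹, (γ.act t ⟨x, hx⟩ : StrongDual ℂ E) = y := by
  have hσ := h.isWStarAction
  constructor
  · intro hxy
    have hx : ι x ∈ ι '' (γ.dom t⁻¹) := by
      rw [h.map_dom]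
      refine ⟨⟨x, rfl⟩, ι y, ⟨y, rfl⟩, ?_⟩
      rw [← hxy, ← hσ.act_mul, inv_mul_cancel, hσ.act_one]
    obtain ⟨z, hz, hzx⟩ := hx
    obtain rfl := h.injective hzx
    exact ⟨hz, h.injective (by rw [h.map_act, hxy])⟩
  · rintro ⟨hx, rfl⟩
    exact (h.map_act t ⟨x, hx⟩).symm

theorem isEnvelopingIdeal (h : IsWStarEnveloping M γ N σ ι) :
    IsEnvelopingIdeal (WStarType.dualEquiv h.isWStarAction.isWStarAlgebra)
      (fun t => WStarType.starHom h.isWStarAction.isWStarAlgebra h.isWStarAction.isWStarAlgebra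
        (σ t) (h.isWStarAction.map_mul t) (h.isWStarAction.map_star t))
      (WStarType.starHom h.isWStarPartialAction.isWStarAlgebra h.isWStarAction.isWStarAlgebra
        ι h.map_mul h.map_star) where
  injective := h.injective
  mul_left a x := h.ideal.mul_mem_left a (ι x) ⟨x, rfl⟩
  mul_right a x := h.ideal.mul_mem_right a (ι x) ⟨x, rfl⟩
  act_one := h.isWStarAction.act_one
  act_mul := h.isWStarAction.act_mul
  separating ψ hψ := by
    have h1 : ∀ x : StrongDual ℂ F, x ψ = 0 := by
      let := wstar F
      have h2 : (Submodule.span ℂ (⋃ t : G, σ t '' Set.range ι) : Set (StrongDual ℂ F)) ⊆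
          {x | x ψ = 0} := by
        intro x hx
        induction hx using Submodule.span_induction with
        | mem x hx =>
          obtain ⟨t, _, ⟨m, rfl⟩, rfl⟩ := Set.mem_iUnion.1 hx
          exact hψ t m
        | zero => rfl
        | add x y _ _ hx hy =>
          change x ψ + y ψ = 0
          rw [show x ψ = 0 from hx, show y ψ = 0 from hy, add_zero]
        | smul c x _ hx =>
          change c • x ψ = 0
          rw [show x ψ = 0 from hx, smul_zero]
      have h3 := closure_minimal h2 (isClosed_wstar_eval_eq_zero ψ)
      rw [h.dense] at h3
      exact fun x => h3 (Set.mem_univ x)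
    by_contra hne
    obtain ⟨g, -, hg⟩ := exists_dual_vector ℂ ψ (norm_ne_zero_iff.2 hne)
    rw [h1 g] at hg
    exact hne (norm_eq_zero.1 (Complex.ofReal_eq_zero.1 hg.symm))

/-- Two W*-enveloping actions of the same W*-partial action are isomorphic. -/
theorem exists_equiv (h : IsWStarEnveloping M γ N σ ι) (h' : IsWStarEnveloping M γ N' σ' ι') :
    ∃ θ : StrongDual ℂ F ≃ₗᵢ[ℂ] StrongDual ℂ F', (∀ x y, θ (N.mul x y) = N'.mul (θ x) (θ y)) ∧
      (∀ x, θ (N.star x) = N'.star (θ x)) ∧ ∀ t x, θ (σ t x) = σ' t (θ x) := by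
  have := h.isWStarAction.isWStarAlgebra.complete
  have := h'.isWStarAction.isWStarAlgebra.complete
  exact h.isEnvelopingIdeal.exists_equiv h'.isEnvelopingIdeal fun r y y' =>
    (h.act_eq_iff r y y').trans (h'.act_eq_iff r y y').symm

end IsWStarEnveloping

end Uniqueness

/-! ### Part (2): transfer of amenability along isomorphisms and changes of predual. -/

section LpMap

variable {I X Y : Type*} [NormedAddCommGroup X] [NormedSpace ℂ X] [NormedAddCommGroup Y]
  [NormedSpace ℂ Y]

/-- Pointwise application of a linear isometry to a bounded function. -/
def lpInftyMap (θ : X →ₗᵢ[ℂ] Y) : lp (fun _ : I => X) ∞ →ₗ[ℂ] lp (fun _ : I => Y) ∞ where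
  toFun f := ⟨fun r => θ (f r), memℓp_infty ⟨‖f‖, by
    rintro _ ⟨r, rfl⟩
    exact (θ.norm_map _).trans_le (lp.norm_apply_le_norm ENNReal.top_ne_zero f r)⟩⟩
  map_add' f g := by ext r; exact θ.map_add _ _
  map_smul' c f := by ext r; exact θ.map_smul _ _

theorem norm_lpInftyMap_le (θ : X →ₗᵢ[ℂ] Y) (f : lp (fun _ : I => X) ∞) :
    ‖lpInftyMap θ f‖ ≤ ‖f‖ :=
  lp.norm_le_of_forall_le (norm_nonneg _) fun r =>
    (θ.norm_map _).trans_le (lp.norm_apply_le_norm ENNReal.top_ne_zero f r)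

end LpMap

section Transfer

variable {G : Type v} [Group G] {F : Type*} [NormedAddCommGroup F] [NormedSpace ℂ F]
  {F' : Type*} [NormedAddCommGroup F'] [NormedSpace ℂ F']
  {N : DualStarAlgebra F} {N' : DualStarAlgebra F'}
  {σ : G → StrongDual ℂ F →ₗ[ℂ] StrongDual ℂ F} {σ' : G → StrongDual ℂ F' →ₗ[ℂ] StrongDual ℂ F'}

/-- W*AD-amenability is invariant under isomorphisms of W*-actions. -/
theorem WStarADAmenable.of_equiv (h : WStarADAmenable N σ)
    (θ : StrongDual ℂ F ≃ₗᵢ[ℂ] StrongDual ℂ F') (hmul : ∀ x y, θ (N.mul x y) = N'.mul (θ x) (θ y))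
    (hstar : ∀ x, θ (N.star x) = N'.star (θ x)) (hact : ∀ t x, θ (σ t x) = σ' t (θ x)) :
    WStarADAmenable N' σ' := by
  obtain ⟨P, hpos, hnorm, hequi, hconst⟩ := h
  let τ := lpInftyMap (I := G) θ.symm.toLinearIsometry
  have hτ (f : lp (fun _ : G => StrongDual ℂ F') ∞) (r : G) : τ f r = θ.symm (f r) := rfl
  refine ⟨θ.toLinearEquiv.toLinearMap ∘ₗ P ∘ₗ τ, fun f k hf => ?_, fun f => ?_, fun t f g hfg => ?_,
    fun x f hf => ?_⟩
  · obtain ⟨y, hy⟩ := hpos (τ f) (τ k) fun r => by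
      refine θ.injective ?_
      rw [hτ, hτ, hmul, hstar, θ.apply_symm_apply, θ.apply_symm_apply, hf]
    refine ⟨θ y, ?_⟩
    change θ (P (τ f)) = _
    rw [hy, hmul, hstar]
  · change ‖θ (P (τ f))‖ ≤ _
    rw [θ.norm_map]
    exact (hnorm _).trans (norm_lpInftyMap_le _ f)
  · change θ (P (τ g)) = σ' t (θ (P (τ f)))
    rw [← hact, hequi t (τ f) (τ g) fun r => ?_]
    refine θ.injective ?_
    rw [hτ, hτ, hact, θ.apply_symm_apply, θ.apply_symm_apply, hfg]
  · change θ (P (τ f)) = x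
    rw [hconst (θ.symm x) (τ f) fun r => by rw [hτ, hf], θ.apply_symm_apply]

/-- The isometry of dual spaces induced by an isometry of preduals. -/
def dualIsometry (k : F' ≃ₗᵢ[ℂ] F) : StrongDual ℂ F ≃ₗᵢ[ℂ] StrongDual ℂ F' where
  toFun x := x.comp (k : F' →L[ℂ] F)
  invFun x := x.comp (k.symm : F →L[ℂ] F')
  left_inv x := by ext; simp
  right_inv x := by ext; simp
  map_add' x y := rfl
  map_smul' c x := rfl
  norm_map' x := by
    refine le_antisymm (ContinuousLinearMap.opNorm_le_bound _ (norm_nonneg _) fun φ => ?_)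
      (ContinuousLinearMap.opNorm_le_bound _ (norm_nonneg _) fun φ => ?_)
    · exact (x.le_opNorm (k φ)).trans_eq (by rw [k.norm_map])
    · have := (x.comp (k : F' →L[ℂ] F)).le_opNorm (k.symm φ)
      rw [k.symm.norm_map] at this
      refine le_trans (le_of_eq ?_) this
      simp

/-- Transport of the multiplication and the involution along an isometry of preduals. -/
def DualStarAlgebra.transport (N : DualStarAlgebra F) (k : F' ≃ₗᵢ[ℂ] F) : DualStarAlgebra F' where
  mul x y := dualIsometry k (N.mul ((dualIsometry k).symm x) ((dualIsometry k).symm y))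
  star x := dualIsometry k (N.star ((dualIsometry k).symm x))

theorem DualStarAlgebra.IsWStarAlgebra.transport (hN : N.IsWStarAlgebra) (k : F' ≃ₗᵢ[ℂ] F) :
    (N.transport k).IsWStarAlgebra where
  complete := by
    have := hN.complete
    exact (completeSpace_congr (e := k.toEquiv) k.isometry.isUniformEmbedding).2 this
  mul_assoc x y z := by simp [DualStarAlgebra.transport, hN.mul_assoc]
  add_mul x y z := by simp [DualStarAlgebra.transport, hN.add_mul]
  mul_add x y z := by simp [DualStarAlgebra.transport, hN.mul_add]
  smul_mul c x y := by simp [DualStarAlgebra.transport, hN.smul_mul]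
  mul_smul c x y := by simp [DualStarAlgebra.transport, hN.mul_smul]
  exists_one := by
    obtain ⟨u, hu⟩ := hN.exists_one
    exact ⟨dualIsometry k u, fun x => by simp [DualStarAlgebra.transport, (hu _).1, (hu _).2]⟩
  star_star x := by simp [DualStarAlgebra.transport, hN.star_star]
  star_add x y := by simp [DualStarAlgebra.transport, hN.star_add]
  star_smul c x := by simp [DualStarAlgebra.transport, hN.star_smul]
  star_mul x y := by simp [DualStarAlgebra.transport, hN.star_mul]
  norm_mul_le x y := by
    simpa [DualStarAlgebra.transport] using
      hN.norm_mul_le ((dualIsometry k).symm x) ((dualIsometry k).symm y)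
  norm_star_mul_self x := by
    simpa [DualStarAlgebra.transport] using hN.norm_star_mul_self ((dualIsometry k).symm x)

theorem continuous_wstar_dualIsometry (k : F' ≃ₗᵢ[ℂ] F) :
    Continuous[wstar F, wstar F'] (dualIsometry k) :=
  (continuous_wstar_iff _ _).2 fun φ => continuous_wstar_eval (k φ)

theorem continuous_wstar_dualIsometry_symm (k : F' ≃ₗᵢ[ℂ] F) :
    Continuous[wstar F', wstar F] (dualIsometry k).symm :=
  (continuous_wstar_iff _ _).2 fun φ => continuous_wstar_eval (k.symm φ)

/-- The homeomorphism of weak-* topologies induced by an isometry of preduals. -/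
def dualHomeomorph (k : F' ≃ₗᵢ[ℂ] F) :
    @Homeomorph (StrongDual ℂ F) (StrongDual ℂ F') (wstar F) (wstar F') :=
  letI := wstar F
  letI := wstar F'
  { (dualIsometry k).toLinearEquiv.toEquiv with
    continuous_toFun := continuous_wstar_dualIsometry k
    continuous_invFun := continuous_wstar_dualIsometry_symm k }

/-- Transport of an action along an isometry of preduals. -/
def transportAction {G : Type*} (σ : G → StrongDual ℂ F →ₗ[ℂ] StrongDual ℂ F) (k : F' ≃ₗᵢ[ℂ] F) (t : G) :
    StrongDual ℂ F' →ₗ[ℂ] StrongDual ℂ F' :=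
  (dualIsometry k).toLinearEquiv.toLinearMap ∘ₗ σ t ∘ₗ (dualIsometry k).symm.toLinearEquiv.toLinearMap

theorem transportAction_apply {G : Type*} (σ : G → StrongDual ℂ F →ₗ[ℂ] StrongDual ℂ F)
    (k : F' ≃ₗᵢ[ℂ] F) (t : G) (x : StrongDual ℂ F') :
    transportAction σ k t x = dualIsometry k (σ t ((dualIsometry k).symm x)) := rfl

theorem IsWStarAction.transport (hσ : IsWStarAction N σ) (k : F' ≃ₗᵢ[ℂ] F) :
    IsWStarAction (N.transport k) (transportAction σ k) where
  isWStarAlgebra := hσ.isWStarAlgebra.transport k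
  map_mul t x y := by simp [DualStarAlgebra.transport, transportAction_apply, hσ.map_mul]
  map_star t x := by simp [DualStarAlgebra.transport, transportAction_apply, hσ.map_star]
  wstar_continuous t := by
    let := wstar F
    let := wstar F'
    exact (continuous_wstar_dualIsometry k).comp
      ((hσ.wstar_continuous t).comp (continuous_wstar_dualIsometry_symm k))
  act_one x := by simp [transportAction_apply, hσ.act_one]
  act_mul s t x := by simp [transportAction_apply, hσ.act_mul]

variable {E : Type*} [NormedAddCommGroup E] [NormedSpace ℂ E] {M : DualStarAlgebra E}
  {γ : PartialFamily G (StrongDual ℂ E)} {ι : StrongDual ℂ E →ₗ[ℂ] StrongDual ℂ F}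

theorem IsWStarEnveloping.transport (h : IsWStarEnveloping M γ N σ ι) (k : F' ≃ₗᵢ[ℂ] F) :
    IsWStarEnveloping M γ (N.transport k) (transportAction σ k)
      ((dualIsometry k).toLinearEquiv.toLinearMap ∘ₗ ι) := by
  have hmem (x : StrongDual ℂ F') :
      x ∈ LinearMap.range ((dualIsometry k).toLinearEquiv.toLinearMap ∘ₗ ι) ↔
        (dualIsometry k).symm x ∈ LinearMap.range ι := by
    constructor
    · rintro ⟨y, rfl⟩
      exact ⟨y, ((dualIsometry k).symm_apply_apply _).symm⟩
    · rintro ⟨y, hy⟩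
      exact ⟨y, by simp [hy]⟩
  have hrange : Set.range ((dualIsometry k).toLinearEquiv.toLinearMap ∘ₗ ι) =
      dualIsometry k '' Set.range ι := by
    rw [← Set.range_comp]; rfl
  have himage (t : G) (s : Set (StrongDual ℂ F)) :
      transportAction σ k t '' (dualIsometry k '' s) = dualIsometry k '' (σ t '' s) := by
    simp [Set.image_image, transportAction_apply]
  refine
    { isWStarPartialAction := h.isWStarPartialAction
      isWStarAction := h.isWStarAction.transport k
      ideal := ⟨fun a x hx => ?_, fun a x hx => ?_, fun x hx => ?_, ?_⟩
      map_mul := fun x y => by simp [DualStarAlgebra.transport, h.map_mul]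
      map_star := fun x => by simp [DualStarAlgebra.transport, h.map_star]
      wstar_embedding := ?_
      map_dom := fun t => ?_
      map_act := fun t x => by simp [transportAction_apply, h.map_act]
      dense := ?_ }
  · rw [hmem] at hx ⊢
    simpa [DualStarAlgebra.transport] using h.ideal.mul_mem_left ((dualIsometry k).symm a) _ hx
  · rw [hmem] at hx ⊢
    simpa [DualStarAlgebra.transport] using h.ideal.mul_mem_right ((dualIsometry k).symm a) _ hx
  · rw [hmem] at hx ⊢
    simpa [DualStarAlgebra.transport] using h.ideal.star_mem _ hx
  · let := wstar F
    let := wstar F'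
    have : (LinearMap.range ((dualIsometry k).toLinearEquiv.toLinearMap ∘ₗ ι) :
        Set (StrongDual ℂ F')) = (dualIsometry k).symm ⁻¹' (LinearMap.range ι) :=
      Set.ext hmem
    rw [this]
    exact h.ideal.isClosed.preimage (continuous_wstar_dualIsometry_symm k)
  · let := wstar E
    let := wstar F
    let := wstar F'
    exact (dualHomeomorph k).isEmbedding.comp h.wstar_embedding
  · have h1 : ((dualIsometry k).toLinearEquiv.toLinearMap ∘ₗ ι) '' (γ.dom t) =
        dualIsometry k '' (ι '' (γ.dom t)) := by
      rw [Set.image_image]; rfl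
    rw [h1, h.map_dom, hrange, himage, Set.image_inter (dualIsometry k).injective]
  · rw [hrange]
    simp only [himage]
    rw [← Set.image_iUnion]
    have h2 : (Submodule.span ℂ (dualIsometry k '' ⋃ t : G, σ t '' Set.range ι) :
        Set (StrongDual ℂ F')) =
        dualIsometry k '' (Submodule.span ℂ (⋃ t : G, σ t '' Set.range ι)) := by
      have := Submodule.map_span (dualIsometry k).toLinearEquiv.toLinearMap
        (⋃ t : G, σ t '' Set.range ι)
      exact (congrArg (SetLike.coe : Submodule ℂ (StrongDual ℂ F') → Set _) this).symm
    rw [h2]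
    let := wstar F
    let := wstar F'
    have h3 := (dualHomeomorph k).image_closure
      (Submodule.span ℂ (⋃ t : G, σ t '' Set.range ι) : Set (StrongDual ℂ F))
    rw [h.dense, Set.image_univ, (dualHomeomorph k).surjective.range_eq] at h3
    exact h3.symm

end Transfer

/-- Amenability of a partial action can be tested on any W*-enveloping action. -/
theorem partialWStarADAmenable_iff {G : Type v} [Group G] {E F : Type u} [NormedAddCommGroup E]
    [NormedSpace ℂ E] [NormedAddCommGroup F] [NormedSpace ℂ F] {M : DualStarAlgebra E}
    {γ : PartialFamily G (StrongDual ℂ E)} {N : DualStarAlgebra F}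
    {σ : G → StrongDual ℂ F →ₗ[ℂ] StrongDual ℂ F} {ι : StrongDual ℂ E →ₗ[ℂ] StrongDual ℂ F}
    (h : IsWStarEnveloping M γ N σ ι) : PartialWStarADAmenable M γ ↔ WStarADAmenable N σ := by
  constructor
  · rintro ⟨F', _, _, N', σ', ι', h', hP⟩
    obtain ⟨θ, hmul, hstar, hact⟩ := h'.exists_equiv h
    exact hP.of_equiv θ hmul hstar hact
  · intro hP
    -- `PartialWStarADAmenable` asks for a predual in `Type (max u v)`, so the given enveloping
    -- action is transported to the lifted predual.
    let k : ULift.{v} F ≃ₗᵢ[ℂ] F := LinearIsometryEquiv.ulift ℂ F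
    exact ⟨ULift.{v} F, inferInstance, inferInstance, N.transport k, transportAction σ k, _,
      h.transport k, hP.of_equiv (dualIsometry k) (fun x y => by simp [DualStarAlgebra.transport])
        (fun x => by simp [DualStarAlgebra.transport]) fun t x => by simp [transportAction_apply]⟩

end

theorem mainTheorem4 {G : Type v} [Group G] {B : Type u} [NonUnitalCStarAlgebra B]
    (β : G →* (B ≃⋆ₐ[ℂ] B)) (A : CStarIdeal B) (hA : IsCStarEnveloping β A) :
    IsWStarEnveloping (bidual A.alg) (restrictAction β A).bidual
        (bidual B) (bidualAction β) A.bidualIncl ∧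
      ((restrictAction β A).ADAmenable ↔ ADAmenable β) :=
  ⟨isWStarEnveloping_bidual β A hA, partialWStarADAmenable_iff (isWStarEnveloping_bidual β A hA)⟩
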